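/- Let $n\ge 1$ and let $L(n)$ be the number of $n\times n$ Latin squares, i.e. of $n\times n$ matrices with entries in $\{1,\dots,n\}$ in which no row and no column contains an entry twice. For an integer $q\ge 0$ put $(-q)\text{¡}=(-q)(-q+1)\cdots(-1)=(-1)^q\,q!$ (the rising factorial of $-q$ with $q$ factors). **First form.** Let $A_n$ be the set of all index sequences $\alpha=(\alpha_n,\dots,\alpha_1)$ of integers with $0\le\alpha_j\le j-1$ for $1\le j\le n$; it has $n!$ elements. If $\alpha_j>0$, the index $\alpha_j$ is said to cover the index $\alpha_{\alpha_j}$, i.e. the one at position $\alpha_j$. For $1\le h\le n$ with $\alpha_h=0$, the component $Z_h$ of $\alpha$ is the set of all indices (each taken together with its position and its value, i.e. as the pair $(j,\alpha_j)$) from which the index $\alpha_h$ is reached by repeatedly (zero or more times) passing to the covered index; if $\alpha_h\ne0$, then $\alpha$ has no component $Z_h$. By convention every $\alpha$ also has the component $Z_0=\emptyset$. For $0\le l\le n$ let $Z_l$ range over all sets that occur as the component $Z_l$ of some $\alpha\in A_n$. For variables $R=\{r_\alpha\}_{\alpha\in A_n}$ and $C=\{c_\alpha\}_{\alpha\in A_n}$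 with values in the nonnegative integers let $q(Z_l)$ be the sum of the $r_\alpha$, and $\tilde q(Z_l)$ the sum of the $c_\alpha$, over all $\alpha$ whose component $Z_l$ is the given set; in particular $q(Z_0)=\sum_\alpha r_\alpha$. Then $$L(n)=n!\sum_{R:\ \sum_\alpha r_\alpha=n}\ \ \sum_{C:\ \tilde q(Z_l)=q(Z_l)}\ \frac{\prod_{l=0}^{n}\prod_{Z_l}(-q(Z_l))\text{¡}}{\prod_\alpha r_\alpha!\ \prod_\alpha c_\alpha!},$$ where the inner sum is over all $C$ that satisfy $\tilde q(Z_l)=q(Z_l)$ for all $1\le l\le n$ and all $Z_l$ (which implies $\sum_\alpha c_\alpha=n$, so that the sum is finite). **Second form.** Let $S_n$ be the group of permutations of $\{1,\dots,n\}$, which also has $n!$ elements. Let $\gamma$ range over all cycles that occur in the cycle decomposition of some $\sigma\in S_n$, where the fixed points count as cycles of length $1$, together with the empty cycle $\emptyset$, which is regarded as a cycle of every $\sigma$. For variables $R=\{r_\sigma\}_{\sigma\in S_n}$ and $C=\{c_\sigma\}_{\sigma\in S_n}$ with values in the nonnegative integers let $q(\gamma)$ be the sum of the $r_\sigma$, and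 $\tilde q(\gamma)$ the sum of the $c_\sigma$, over all $\sigma$ that have $\gamma$ as a cycle; in particular $q(\emptyset)=\sum_\sigma r_\sigma$. Then $$L(n)=n!\sum_{R:\ \sum_\sigma r_\sigma=n}\ \ \sum_{C:\ \tilde q(\gamma)=q(\gamma)}\ \frac{\prod_{\gamma}(-q(\gamma))\text{¡}}{\prod_\sigma r_\sigma!\ \prod_\sigma c_\sigma!},$$ where the inner sum is over all $C$ that satisfy $\tilde q(\gamma)=q(\gamma)$ for all nonempty cycles $\gamma$ (which implies $\sum_\sigma c_\sigma=n$), and the product is over all $\gamma$, including the empty cycle. -/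

import Mathlib

namespace LatinFormula

/-- The number `L(n)` of `n × n` Latin squares: matrices with entries in an `n`-element set in
which no row and no column contains an entry twice. -/
noncomputable def latinSquareCount (n : ℕ) : ℕ :=
  Nat.card {M : Matrix (Fin n) (Fin n) (Fin n) //
    (∀ i, Function.Injective fun j => M i j) ∧ (∀ j, Function.Injective fun i => M i j)}

/-- The inverted factorial `x¡`, that is the rising factorial `x (x + 1) ⋯ (x + k - 1)` with
`k = |x|` factors. -/
def invFactorial (x : ℤ) : ℤ := ∏ i ∈ Finset.range x.natAbs, (x + i)

theorem invFactorial_neg (q : ℕ) : invFactorial (-(q : ℤ)) = (-1) ^ q * (q.factorial : ℤ) := by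
  unfold invFactorial
  have h : ((-1 : ℤ)) ^ q = ∏ _i ∈ Finset.range q, (-1 : ℤ) := by simp
  rw [Int.natAbs_neg, Int.natAbs_natCast, ← Finset.prod_range_reflect,
    ← Finset.prod_range_add_one_eq_factorial, h]
  push_cast
  rw [← Finset.prod_mul_distrib]
  refine Finset.prod_congr rfl fun i hi => ?_
  have : i < q := Finset.mem_range.1 hi
  rw [Nat.sub_sub, Nat.cast_sub (by omega)]
  push_cast
  ring

/-! ### Index sequences and their components -/

/-- The sequences of indices `α_n, …, α_1` with `0 ≤ α_j ≤ j - 1` for all `j ∈ {1, …, n}`; the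
index `α_j` is stored at the position `j - 1` of `Fin n`. -/
abbrev IndexSeq (n : ℕ) : Type := (j : Fin n) → Fin (j.val + 1)

/-- There are `n!` index sequences. -/
theorem card_indexSeq (n : ℕ) : Fintype.card (IndexSeq n) = n.factorial := by
  rw [Fintype.card_pi]
  simp only [Fintype.card_fin]
  rw [Fin.prod_univ_eq_prod_range (fun i => i + 1) n, Finset.prod_range_add_one_eq_factorial]

/-- The index `α_j`, for `j ∈ {1, …, n}` (and `0` for the positions `j` that do not exist). -/
def IndexSeq.idx {n : ℕ} (α : IndexSeq n) (j : ℕ) : ℕ :=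
  if h : 1 ≤ j ∧ j ≤ n then (α ⟨j - 1, by omega⟩).val else 0

open Classical in
/-- The component `Z_h` of the indices `α_n, …, α_1`. An index `α_j > 0` covers the index at the
position `α_j`, so passing to the covered index is the map `j ↦ α_j` on positions. If `h ≥ 1` and
`α_h = 0`, then `Z_h` consists of all the indices, each recorded as the pair `(j, α_j)` of its
position and its value, from which `α_h` is reached by repeated covering. There is no such
component if `α_h ≠ 0`, nor for `h = 0`; the value is then the empty set. -/
noncomputable def IndexSeq.component {n : ℕ} (α : IndexSeq n) (h : ℕ) : Finset (ℕ × ℕ) :=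
  ((Finset.Icc 1 n).filter
    (fun j => 1 ≤ h ∧ α.idx h = 0 ∧ ∃ k : ℕ, α.idx^[k] j = h)).image fun j => (j, α.idx j)

/-- The possible values of `Z_l`: for `l ≥ 1` these are the components `Z_l` of those index
sequences that have one, and for `l = 0` there is the single value `Z_0 = ∅`. -/
noncomputable def components (n l : ℕ) : Finset (Finset (ℕ × ℕ)) :=
  (Finset.univ.filter fun α : IndexSeq n => α.idx l = 0).image fun α => α.component l

/-- The sum of the variables `x_α` over all the `α` whose component `Z_l` is `Z`: this is `q(Z_l)`
for the variables `r` and `∑ Q̃(Z_l)` for the variables `c`. For `l = 0` and `Z = ∅` it is the sum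
of all the variables. -/
noncomputable def compSum {n : ℕ} (x : IndexSeq n → ℕ) (l : ℕ) (Z : Finset (ℕ × ℕ)) : ℕ :=
  ∑ α ∈ Finset.univ.filter (fun α : IndexSeq n => α.component l = Z), x α

open Classical in
/-- The families `c` of nonnegative integers of total `n` with `∑ Q̃(Z_l) = q(Z_l)` for all the
components `Z_l`, `l ∈ {1, …, n}`. -/
noncomputable def compMatching {n : ℕ} (r : IndexSeq n → ℕ) : Finset (IndexSeq n → ℕ) :=
  (Finset.piAntidiag Finset.univ n).filter fun c =>
    ∀ l ∈ Finset.Icc 1 n, ∀ Z ∈ components n l, compSum c l Z = compSum r l Z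

theorem IndexSeq.component_zero {n : ℕ} (α : IndexSeq n) : α.component 0 = ∅ := by
  simp [IndexSeq.component]

theorem IndexSeq.idx_zero {n : ℕ} (α : IndexSeq n) : α.idx 0 = 0 := by
  simp [IndexSeq.idx]

theorem IndexSeq.idx_one {n : ℕ} (α : IndexSeq n) : α.idx 1 = 0 := by
  unfold IndexSeq.idx
  split_ifs with h
  · have := (α ⟨1 - 1, by omega⟩).isLt
    simp only at this
    omega
  · rfl

theorem components_zero (n : ℕ) : components n 0 = {∅} := by
  unfold components
  ext Z
  simp only [IndexSeq.idx_zero, IndexSeq.component_zero, Finset.mem_image, Finset.mem_filter,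
    Finset.mem_univ, Finset.mem_singleton, true_and]
  exact ⟨fun ⟨_, h⟩ => h.symm, fun h => ⟨fun _ => 0, h.symm⟩⟩

theorem compSum_zero {n : ℕ} (x : IndexSeq n → ℕ) : compSum x 0 ∅ = ∑ α, x α := by
  simp [compSum, IndexSeq.component_zero]

theorem sum_eq_sum_compSum_one {n : ℕ} (x : IndexSeq n → ℕ) :
    ∑ α, x α = ∑ Z ∈ components n 1, compSum x 1 Z := by
  unfold compSum
  refine (Finset.sum_fiberwise_of_maps_to (fun α _ => ?_) _).symm
  exact Finset.mem_image.2 ⟨α, by simp [IndexSeq.idx_one], rfl⟩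

/-- The total of `c` is forced by the other conditions. -/
theorem mem_compMatching_iff {n : ℕ} (hn : 1 ≤ n) {r : IndexSeq n → ℕ} (hr : ∑ α, r α = n)
    (c : IndexSeq n → ℕ) : c ∈ compMatching r ↔
      ∀ l ∈ Finset.Icc 1 n, ∀ Z ∈ components n l, compSum c l Z = compSum r l Z := by
  unfold compMatching
  simp only [Finset.mem_filter, Finset.mem_piAntidiag]
  refine ⟨fun h => h.2, fun h => ⟨⟨?_, fun _ _ => Finset.mem_univ _⟩, h⟩⟩
  refine Eq.trans ?_ hr
  rw [sum_eq_sum_compSum_one c, sum_eq_sum_compSum_one r]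
  exact Finset.sum_congr rfl fun Z hZ => h 1 (by simp [hn]) Z hZ

/-! ### Cycles -/

/-- The cycles on distinct elements of an `n`-element set. The cycles of length one (fixed points)
are included, and so is the empty cycle `Cycle.nil`. -/
abbrev SimpleCycle (n : ℕ) : Type := {γ : Cycle (Fin n) // γ.Nodup}

/-- `γ` is a cycle of the permutation `σ`: `σ` maps each element of `γ` to the next one. The empty
cycle is counted as a cycle of every permutation. -/
def CycleOf {n : ℕ} (γ : SimpleCycle n) (σ : Equiv.Perm (Fin n)) : Prop :=
  γ.1.Chain fun a b => σ a = b

open Classical in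
/-- The sum of the variables `x_σ` over all the permutations `σ` that have `γ` as a cycle: this is
`q(γ)` for the variables `r` and `∑ Q̃(γ)` for the variables `c`. For the empty cycle it is the sum
of all the variables. -/
noncomputable def cycleSum {n : ℕ} (x : Equiv.Perm (Fin n) → ℕ) (γ : SimpleCycle n) : ℕ :=
  ∑ σ ∈ Finset.univ.filter (fun σ => CycleOf γ σ), x σ

open Classical in
/-- The families `c` of nonnegative integers of total `n` with `∑ Q̃(γ) = q(γ)` for all the
nonempty cycles `γ`. -/
noncomputable def cycleMatching {n : ℕ} (r : Equiv.Perm (Fin n) → ℕ) :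
    Finset (Equiv.Perm (Fin n) → ℕ) :=
  (Finset.piAntidiag Finset.univ n).filter fun c =>
    ∀ γ : SimpleCycle n, γ.1 ≠ Cycle.nil → cycleSum c γ = cycleSum r γ

theorem cycleOf_nil {n : ℕ} (σ : Equiv.Perm (Fin n)) : CycleOf ⟨Cycle.nil, Cycle.nodup_nil⟩ σ :=
  Cycle.Chain.nil _

theorem cycleSum_nil {n : ℕ} (x : Equiv.Perm (Fin n) → ℕ) :
    cycleSum x ⟨Cycle.nil, Cycle.nodup_nil⟩ = ∑ σ, x σ := by
  simp [cycleSum, cycleOf_nil]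

theorem cycleOf_iff_periodicOrbit_eq {n : ℕ} (γ : SimpleCycle n) (x : Fin n) (hx : x ∈ γ.1)
    (σ : Equiv.Perm (Fin n)) : CycleOf γ σ ↔ Function.periodicOrbit σ x = γ.1 := by
  have hper (y : Fin n) : y ∈ Function.periodicPts σ :=
    σ.injective.mem_periodicPts y
  constructor
  · obtain ⟨γ, hγ⟩ := γ
    intro h
    induction γ using Quotient.inductionOn' with | _ L
    change x ∈ L at hx
    change L.Nodup at hγ
    obtain ⟨k, hk⟩ : ∃ k l, L.rotate k = x :: l := by
      obtain ⟨s, t, rfl⟩ := List.append_of_mem hx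
      exact ⟨s.length, t ++ s, by simp [List.rotate_append_length_eq]⟩
    obtain ⟨l, hl⟩ := hk
    have hL : (Quotient.mk'' L : Cycle (Fin n)) = ((x :: l : List (Fin n)) : Cycle (Fin n)) := by
      exact Cycle.coe_eq_coe.2 ⟨k, hl⟩
    have hnd : (x :: l).Nodup := by rw [← hl]; exact List.nodup_rotate.2 hγ
    change Cycle.Chain (fun a b => σ a = b) (Quotient.mk'' L) at h
    change _ = (Quotient.mk'' L : Cycle (Fin n))
    rw [hL] at h ⊢
    rw [Cycle.chain_coe_cons, List.isChain_iff_getElem] at h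
    have hiter : ∀ i (hi : i < (x :: (l ++ [x])).length), (x :: (l ++ [x]))[i] = σ^[i] x := by
      intro i
      induction i with
      | zero => intro _; simp
      | succ i ih =>
        intro hi
        rw [Function.iterate_succ_apply', ← ih (by omega)]
        exact (h i (by simpa using hi)).symm
    have hlen : Function.IsPeriodicPt σ (l.length + 1) x := by
      have := hiter (l.length + 1) (by simp)
      simp at this
      exact this.symm
    have hpos : 0 < Function.minimalPeriod σ x :=
      Function.minimalPeriod_pos_of_mem_periodicPts (hper x)
    have hle : Function.minimalPeriod σ x ≤ l.length + 1 := hlen.minimalPeriod_le (by omega)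
    have hin : ∀ i (hi : i < (x :: l).length), (x :: l)[i] = σ^[i] x := by
      intro i hi
      rw [← hiter i (by simp at hi ⊢; omega)]
      simp only [← List.cons_append]
      rw [List.getElem_append_left]
    have hmin : Function.minimalPeriod σ x = l.length + 1 := by
      by_contra hne
      have hlt : Function.minimalPeriod σ x < (x :: l).length := by simp; omega
      have h0 := hin _ hlt
      rw [Function.iterate_minimalPeriod] at h0
      have h1 : (x :: l)[Function.minimalPeriod σ x] = (x :: l)[0] := by simpa using h0
      have := (List.Nodup.getElem_inj_iff hnd).1 h1
      omega
    rw [Function.periodicOrbit_def, hmin]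
    congr 1
    refine List.ext_getElem (by simp) fun i h1 h2 => ?_
    rw [hin i h2, List.getElem_map, List.getElem_range]
  · intro h
    unfold CycleOf
    rw [← h]
    refine (Function.periodicOrbit_chain' _ (hper x)).2 fun i => ?_
    rw [Function.iterate_succ_apply']

theorem sum_eq_sum_cycleSum {n : ℕ} (x : Fin n) (f : Equiv.Perm (Fin n) → ℕ) :
    ∑ σ, f σ = ∑ γ ∈ Finset.univ.filter (fun γ : SimpleCycle n => x ∈ γ.1), cycleSum f γ := by
  classical
  rw [← Finset.sum_fiberwise_of_maps_to
    (g := fun σ : Equiv.Perm (Fin n) =>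
      (⟨Function.periodicOrbit σ x, Function.nodup_periodicOrbit⟩ : SimpleCycle n))
    (t := Finset.univ.filter (fun γ : SimpleCycle n => x ∈ γ.1))]
  · refine Finset.sum_congr rfl fun γ hγ => ?_
    unfold cycleSum
    refine Finset.sum_congr ?_ fun _ _ => rfl
    ext σ
    simp [cycleOf_iff_periodicOrbit_eq γ x (Finset.mem_filter.1 hγ).2, Subtype.ext_iff]
  · intro σ _
    simp [Function.self_mem_periodicOrbit (σ.injective.mem_periodicPts x)]

/-- The total of `c` is forced by the other conditions. -/
theorem mem_cycleMatching_iff {n : ℕ} (hn : 1 ≤ n) {r : Equiv.Perm (Fin n) → ℕ}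
    (hr : ∑ σ, r σ = n) (c : Equiv.Perm (Fin n) → ℕ) : c ∈ cycleMatching r ↔
      ∀ γ : SimpleCycle n, γ.1 ≠ Cycle.nil → cycleSum c γ = cycleSum r γ := by
  unfold cycleMatching
  simp only [Finset.mem_filter, Finset.mem_piAntidiag]
  refine ⟨fun h => h.2, fun h => ⟨⟨?_, fun _ _ => Finset.mem_univ _⟩, h⟩⟩
  refine Eq.trans ?_ hr
  rw [sum_eq_sum_cycleSum ⟨0, hn⟩ c, sum_eq_sum_cycleSum ⟨0, hn⟩ r]
  refine Finset.sum_congr rfl fun γ hγ => h γ fun h0 => ?_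
  have := (Finset.mem_filter.1 hγ).2
  rw [h0] at this
  exact Cycle.notMem_nil _ this

end LatinFormula

/-!
Both formulas count Latin squares by the same cancellation. A permutation of `Fin n` decomposes
into cycles, and an index sequence decomposes into components, which are trees in which each
index but the root covers one at a smaller position. The two decompositions share the following
properties, collected in `ComponentSystem`: a family of components whose supports partition `Fin
n` comes from exactly one structure, there is exactly one component on each single point, and on
a set of at least two elements the structures counted with the sign `(-1) ^ #components` cancel.
For permutations the last property holds because there are as many even as odd ones
(`signed_sum_perm_eq_zero`); for index sequences the second smallest element of the set may be
attached to the smallest one or detached from it (`IndexSeq.signed_sum_eq_zero`).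

The factor `n! / ∏ r!` is the number of sequences `σ 1, …, σ n` of structures in which each `ω`
occurs `r ω` times, and likewise for `c` and sequences `τ 1, …, τ n`; the second `n!` is that of
the factor `(-n)¡` of the empty component. The factor `q(γ)!` of a nonempty component is the
number of ways to match the occurrences of the component `γ` in the sequence `σ` with those in
`τ` (`card_matchings`). If an occurrence of `γ` in `σ i` is matched with one in `τ j`, write `γ`
into the cell `(i, j)` of an `n × n` array. The formula then becomes the signed number of arrays
of sets of components in which the supports in every row and in every column partition `Fin n`
(`ComponentSystem.sum_sequences_eq_latinSquareCount`).

Now fix the set `S i j` of elements covered in each cell. The sum over the arrays with these sets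
is the product over the cells of the signed numbers of structures on `S i j`, which vanishes as
soon as some `S i j` has two elements. Since every row covers `n` elements with `n` cells, only
the arrays of singletons survive, and these are the Latin squares
(`ComponentSystem.sum_isLatinArray_eq_latinSquareCount`). Each of them has the sign
`(-1) ^ (n * n) = (-1) ^ n`, which is offset by the sign of the factor `(-n)¡`.
-/

namespace LatinFormula

/-! ### Sequences of given type and matchings of occurrences -/

/-- There are `n! / ∏ r ω !` sequences of length `n` in which every `ω` occurs `r ω` times: both
sides are the coefficient of `∏ X ω ^ r ω` in `(∑ X ω) ^ n`. -/
theorem card_sequences_mul_prod_factorial {Ω : Type*} [Fintype Ω] [DecidableEq Ω] {n : ℕ}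
    {r : Ω → ℕ} (hr : ∑ ω, r ω = n) :
    (Finset.univ.filter fun σ : Fin n → Ω =>
      (fun ω => (Finset.univ.filter fun i => σ i = ω).card) = r).card * ∏ ω, (r ω).factorial
      = n.factorial := by
  have hX (k : Ω → ℕ) : ∏ ω, (MvPolynomial.X ω : MvPolynomial Ω ℕ) ^ k ω
      = MvPolynomial.monomial (Finsupp.equivFunOnFinite.symm k) 1 := by
    rw [MvPolynomial.monomial_eq, Finsupp.prod_fintype _ _ (by simp)]
    simp
  have h1 : (∑ ω, (MvPolynomial.X ω : MvPolynomial Ω ℕ)) ^ n =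
      ∑ σ : Fin n → Ω, MvPolynomial.monomial (Finsupp.equivFunOnFinite.symm
        fun ω => (Finset.univ.filter fun i => σ i = ω).card) 1 := by
    rw [Fintype.sum_pow]
    refine Finset.sum_congr rfl fun σ _ => ?_
    rw [← hX, ← Finset.prod_fiberwise Finset.univ σ]
    refine Finset.prod_congr rfl fun ω _ => ?_
    rw [Finset.prod_congr rfl (g := fun _ => MvPolynomial.X ω), Finset.prod_const]
    intro i hi
    rw [(Finset.mem_filter.1 hi).2]
  rw [Finset.sum_pow_eq_sum_piAntidiag] at h1
  replace h1 := congrArg (MvPolynomial.coeff (Finsupp.equivFunOnFinite.symm r)) h1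
  have hc (a : ℕ) (k : Ω → ℕ) : MvPolynomial.coeff (Finsupp.equivFunOnFinite.symm r)
      ((a : MvPolynomial Ω ℕ) * MvPolynomial.monomial (Finsupp.equivFunOnFinite.symm k) 1)
      = if k = r then a else 0 := by
    rw [← map_natCast (MvPolynomial.C (R := ℕ) (σ := Ω)), MvPolynomial.coeff_C_mul,
      MvPolynomial.coeff_monomial]
    simp
  simp only [MvPolynomial.coeff_sum, hX, hc] at h1
  simp only [MvPolynomial.coeff_monomial, EmbeddingLike.apply_eq_iff_eq, Finset.sum_boole] at h1
  rw [Finset.sum_ite_eq' , if_pos (by simp [hr])] at h1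
  simp only [Nat.cast_id] at h1
  rw [← h1, mul_comm, Nat.multinomial_spec, hr]

theorem sum_sequences_eq_sum_piAntidiag {Ω : Type*} [Fintype Ω] [DecidableEq Ω] {n : ℕ}
    (g : (Ω → ℕ) → ℚ) :
    ∑ σ : Fin n → Ω, g (fun ω => (Finset.univ.filter fun i => σ i = ω).card) =
      ∑ r ∈ Finset.piAntidiag (Finset.univ : Finset Ω) n,
        n.factorial / (∏ ω, ((r ω).factorial : ℚ)) * g r := by
  rw [← Finset.sum_fiberwise_of_maps_to (t := Finset.piAntidiag (Finset.univ : Finset Ω) n)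
    (g := fun (σ : Fin n → Ω) ω => (Finset.univ.filter fun i => σ i = ω).card)]
  · refine Finset.sum_congr rfl fun r hr => ?_
    rw [Finset.sum_congr rfl (g := fun _ => g r), Finset.sum_const, nsmul_eq_mul]
    · congr 1
      have := card_sequences_mul_prod_factorial (Finset.mem_piAntidiag.1 hr).1
      rw [← this, Nat.cast_mul, Nat.cast_prod, mul_div_cancel_right₀]
      exact Finset.prod_ne_zero_iff.2 fun ω _ => by positivity
    · intro σ hσ
      rw [(Finset.mem_filter.1 hσ).2]
  · intro σ _
    rw [Finset.mem_piAntidiag]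
    refine ⟨?_, fun _ _ => Finset.mem_univ _⟩
    have := Finset.card_eq_sum_card_fiberwise (f := σ) (s := Finset.univ) (t := Finset.univ)
      (by simp [Set.MapsTo])
    simpa using this.symm

/-- The relation `m` is the graph of a function with domain `A`. -/
def HasDomain {ι κ : Type*} (A : ι → Prop) (m : ι → κ → Prop) : Prop :=
  (∀ i j, m i j → A i) ∧ ∀ i, A i → ∃! j, m i j

/-- The relation `m` is the graph of a bijection from `A` onto `B`. -/
def IsMatchingBetween {ι κ : Type*} (A : ι → Prop) (B : κ → Prop) (m : ι → κ → Prop) : Prop :=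
  HasDomain A m ∧ HasDomain B fun j i => m i j

theorem isMatchingBetween_iff {ι κ : Type*} {A : ι → Prop} {B : κ → Prop} {m : ι → κ → Prop} :
    IsMatchingBetween A B m ↔ (∀ i j, m i j → A i ∧ B j) ∧ (∀ i, A i → ∃! j, m i j) ∧
      (∀ j, B j → ∃! i, m i j) := by
  unfold IsMatchingBetween HasDomain
  grind

open Classical in
theorem IsMatchingBetween.card_eq {ι : Type*} [Fintype ι] {A B : ι → Prop} [DecidablePred A]
    {m : Finset (ι × ι)}
    (h : IsMatchingBetween A B fun i j => (i, j) ∈ m) : m.card = (Finset.univ.filter A).card := by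
  refine Finset.card_nbij Prod.fst (fun p hp => by simpa using h.1.1 _ _ hp) ?_ ?_
  · rintro ⟨i, j⟩ hp ⟨i', j'⟩ hp' (rfl : i = i')
    rw [(h.1.2 i (h.1.1 _ _ hp)).unique hp hp']
  · intro i hi
    obtain ⟨j, hj, -⟩ := h.1.2 i (by simpa using hi)
    exact ⟨(i, j), hj, rfl⟩

open Classical in
/-- The matchings between `A` and `B`, encoded as sets of pairs, are the graphs of the bijections
`A ≃ B`. This is the combinatorial meaning of the factorials `q!` in the formula, and of the
condition that `r` and `c` have equal sums over the structures with a given component. -/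
theorem card_matchings {ι : Type*} [Fintype ι] (A B : ι → Prop) [DecidablePred A]
    [DecidablePred B] :
    (Finset.univ.filter fun m : Finset (ι × ι) =>
        IsMatchingBetween A B fun i j => (i, j) ∈ m).card =
      if (Finset.univ.filter A).card = (Finset.univ.filter B).card
      then (Finset.univ.filter A).card.factorial else 0 := by
  let graph (e : {i // A i} ≃ {j // B j}) : Finset (ι × ι) :=
    Finset.univ.filter fun p => ∃ h : A p.1, (e ⟨p.1, h⟩).1 = p.2
  have mem_graph (e) (i j : ι) : (i, j) ∈ graph e ↔ ∃ h : A i, (e ⟨i, h⟩).1 = j := by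
    simp [graph]
  have key : (Finset.univ.filter fun m : Finset (ι × ι) =>
      IsMatchingBetween A B fun i j => (i, j) ∈ m).card =
      Fintype.card ({i // A i} ≃ {j // B j}) := by
    refine (Finset.card_bij (fun e _ => graph e) (fun e _ => ?_) (fun e _ e' _ h => ?_)
      fun m hm => ?_).symm
    · refine Finset.mem_filter.2 ⟨Finset.mem_univ _, isMatchingBetween_iff.2
        ⟨fun i j h => ?_, fun i h => ⟨(e ⟨i, h⟩).1, (mem_graph e _ _).2 ⟨h, rfl⟩, fun j hj => ?_⟩,
          fun j h => ⟨(e.symm ⟨j, h⟩).1, (mem_graph e _ _).2 ⟨(e.symm ⟨j, h⟩).2, by simp⟩,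
            fun i hi => ?_⟩⟩⟩
      · obtain ⟨hi, rfl⟩ := (mem_graph e _ _).1 h
        exact ⟨hi, (e ⟨i, hi⟩).2⟩
      · exact ((mem_graph e _ _).1 hj).2.symm
      · obtain ⟨h, rfl⟩ := (mem_graph e _ _).1 hi
        simp
    · refine Equiv.ext fun i => Subtype.ext ?_
      have hi : (i.1, (e i).1) ∈ graph e := (mem_graph e _ _).2 ⟨i.2, rfl⟩
      rw [show graph e = graph e' from h, mem_graph] at hi
      exact hi.2.symm
    · obtain ⟨h1, h2, h3⟩ := isMatchingBetween_iff.1 (Finset.mem_filter.1 hm).2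
      choose f hf hf' using h2
      let e : {i // A i} ≃ {j // B j} := Equiv.ofBijective
        (fun i => ⟨f i.1 i.2, (h1 _ _ (hf i.1 i.2)).2⟩) <| by
          constructor
          · intro i i' hii
            refine Subtype.ext ((h3 _ (h1 _ _ (hf i.1 i.2)).2).unique (hf i.1 i.2) ?_)
            rw [show f i.1 i.2 = f i'.1 i'.2 from Subtype.ext_iff.1 hii]
            exact hf i'.1 i'.2
          · rintro ⟨j, hj⟩
            obtain ⟨i, hi, -⟩ := h3 j hj
            exact ⟨⟨i, (h1 _ _ hi).1⟩, Subtype.ext (hf' _ _ _ hi).symm⟩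
      refine ⟨e, Finset.mem_univ _, Finset.ext fun p => ?_⟩
      rw [mem_graph e p.1 p.2]
      exact ⟨fun ⟨h, h'⟩ => by
        rw [show p = (p.1, f p.1 h) from Prod.ext rfl h'.symm]; exact hf p.1 h,
        fun hp => ⟨(h1 _ _ hp).1, (hf' _ _ _ hp).symm⟩⟩
  rw [key]
  split_ifs with h
  · rw [← Fintype.card_subtype, ← Fintype.card_subtype] at h
    rw [Fintype.card_equiv (Fintype.equivOfCardEq h), Fintype.card_subtype]
  · rw [Fintype.card_eq_zero_iff]
    refine ⟨fun e => h ?_⟩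
    rw [← Fintype.card_subtype, ← Fintype.card_subtype]
    exact Fintype.card_congr e

/-! ### Decompositions into components -/

open Classical in
/-- A class `Ω` of structures on `Fin n`, each of which decomposes into components from `Γ`, such
that the decompositions are all the possible ones and the signed number of structures on any set
of at least two elements vanishes.

Structures on a subset `S` are encoded as structures on `Fin n` that have the one-point component
at every `v ∉ S`. -/
structure ComponentSystem (n : ℕ) (Ω Γ : Type*) [Fintype Ω] where
  /-- The components of a structure. -/
  comp : Ω → Finset Γ
  /-- The set of elements on which a component lives. -/
  supp : Γ → Finset (Fin n)
  /-- The only component that lives on a single given element. -/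
  point : Fin n → Γ
  supp_nonempty : ∀ γ, (supp γ).Nonempty
  supp_eq_singleton_iff : ∀ γ v, supp γ = {v} ↔ γ = point v
  existsUnique_mem_comp : ∀ ω v, ∃! γ, γ ∈ comp ω ∧ v ∈ supp γ
  /-- Components whose supports partition `Fin n` are the components of exactly one structure. -/
  existsUnique_comp_eq : ∀ F : Finset Γ, (∀ v, ∃! γ, γ ∈ F ∧ v ∈ supp γ) → ∃! ω, comp ω = F
  signed_sum : ∀ S : Finset (Fin n), 2 ≤ S.card →
    ∑ ω with (∀ v, v ∉ S → point v ∈ comp ω), (-1 : ℚ) ^ (comp ω).card = 0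

namespace ComponentSystem

variable {n : ℕ} {Ω Γ : Type*} [Fintype Ω] (K : ComponentSystem n Ω Γ)

/-- The supports of the members of `F` form a partition of `S`. -/
def IsAssembly (F : Finset Γ) (S : Finset (Fin n)) : Prop :=
  (∀ γ ∈ F, K.supp γ ⊆ S) ∧ ∀ v ∈ S, ∃! γ, γ ∈ F ∧ v ∈ K.supp γ

theorem supp_point (v : Fin n) : K.supp (K.point v) = {v} :=
  (K.supp_eq_singleton_iff _ _).2 rfl

variable {K} in
theorem IsAssembly.biUnion_supp {F : Finset Γ} {S : Finset (Fin n)} (h : K.IsAssembly F S) :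
    F.biUnion K.supp = S := by
  ext v
  simp only [Finset.mem_biUnion]
  refine ⟨fun ⟨γ, hγ, hv⟩ => h.1 γ hγ hv, fun hv => ?_⟩
  obtain ⟨γ, hγ, -⟩ := h.2 v hv
  exact ⟨γ, hγ⟩

theorem isAssembly_singleton_iff {F : Finset Γ} {v : Fin n} :
    K.IsAssembly F {v} ↔ F = {K.point v} := by
  constructor
  · intro h
    have hp : ∀ γ ∈ F, γ = K.point v := fun γ hγ => by
      rw [← K.supp_eq_singleton_iff]
      exact (Finset.subset_singleton_iff.1 (h.1 γ hγ)).resolve_left (K.supp_nonempty γ).ne_empty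
    obtain ⟨γ, ⟨hγ, -⟩, -⟩ := h.2 v (by simp)
    refine Finset.eq_singleton_iff_unique_mem.2 ⟨hp γ hγ ▸ hγ, hp⟩
  · rintro rfl
    refine ⟨by simp [supp_point], fun w hw => ⟨K.point v, ?_, ?_⟩⟩
    · simpa [supp_point] using hw
    · simp

variable {K} in
open Classical in
/-- An assembly on `S` is completed to a decomposition of all of `Fin n` by one-point components. -/
theorem IsAssembly.union_points {F : Finset Γ} {S : Finset (Fin n)} (h : K.IsAssembly F S)
    (v : Fin n) : ∃! γ, γ ∈ F ∪ Sᶜ.image K.point ∧ v ∈ K.supp γ := by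
  by_cases hv : v ∈ S
  · obtain ⟨γ, hγ, hu⟩ := h.2 v hv
    refine ⟨γ, ⟨Finset.mem_union_left _ hγ.1, hγ.2⟩, ?_⟩
    rintro γ' ⟨h1, h2⟩
    rcases Finset.mem_union.1 h1 with h1 | h1
    · exact hu γ' ⟨h1, h2⟩
    · obtain ⟨w, hw, rfl⟩ := Finset.mem_image.1 h1
      rw [supp_point, Finset.mem_singleton] at h2
      subst h2
      exact absurd hv (by simpa using hw)
  · refine ⟨K.point v, ⟨Finset.mem_union_right _ (Finset.mem_image_of_mem _ (by simpa)), ?_⟩, ?_⟩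
    · simp [supp_point]
    rintro γ' ⟨h1, h2⟩
    rcases Finset.mem_union.1 h1 with h1 | h1
    · exact absurd (h.1 γ' h1 h2) hv
    · obtain ⟨w, hw, rfl⟩ := Finset.mem_image.1 h1
      rw [supp_point, Finset.mem_singleton] at h2
      rw [h2]

variable [Fintype Γ]

open Classical in
/-- The signed number of assemblies on `S`. -/
noncomputable def signedCount (S : Finset (Fin n)) : ℚ :=
  ∑ F with K.IsAssembly F S, (-1 : ℚ) ^ F.card

theorem signedCount_singleton (v : Fin n) : K.signedCount {v} = -1 := by
  classical
  simp [signedCount, isAssembly_singleton_iff, Finset.filter_eq']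

/-- Adding the one-point components outside `S` turns the assemblies on `S` into the structures on
`Fin n` to which the field `signed_sum` applies, and multiplies all signs by `(-1) ^ #Sᶜ`. -/
theorem signedCount_eq_zero {S : Finset (Fin n)} (hS : 2 ≤ S.card) : K.signedCount S = 0 := by
  classical
  have hdis {F : Finset Γ} (h : K.IsAssembly F S) : Disjoint F (Sᶜ.image K.point) := by
    refine Finset.disjoint_left.2 fun γ hγ hγ' => ?_
    obtain ⟨w, hw, rfl⟩ := Finset.mem_image.1 hγ'
    have := h.1 _ hγ
    rw [supp_point, Finset.singleton_subset_iff] at this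
    exact Finset.mem_compl.1 hw this
  have key : (∑ F with K.IsAssembly F S, (-1 : ℚ) ^ (F ∪ Sᶜ.image K.point).card) = 0 := by
    rw [← K.signed_sum S hS]
    refine (Finset.sum_bij (fun ω _ => (K.comp ω) \ Sᶜ.image K.point) ?_ ?_ ?_ ?_).symm
    · intro ω hω
      replace hω := (Finset.mem_filter.1 hω).2
      refine Finset.mem_filter.2 ⟨Finset.mem_univ _, fun γ hγ v hv => ?_, fun v hv => ?_⟩
      · by_contra hvS
        rw [Finset.mem_sdiff] at hγ
        refine hγ.2 (Finset.mem_image.2 ⟨v, by simpa using hvS, ?_⟩)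
        exact (K.existsUnique_mem_comp ω v).unique ⟨hω v hvS, by simp [supp_point]⟩ ⟨hγ.1, hv⟩
      · obtain ⟨γ, hγ, hu⟩ := K.existsUnique_mem_comp ω v
        refine ⟨γ, ⟨Finset.mem_sdiff.2 ⟨hγ.1, fun h => ?_⟩, hγ.2⟩,
          fun γ' h => hu γ' ⟨(Finset.mem_sdiff.1 h.1).1, h.2⟩⟩
        obtain ⟨w, hw, rfl⟩ := Finset.mem_image.1 h
        have := hγ.2
        rw [supp_point, Finset.mem_singleton] at this
        subst this
        exact Finset.mem_compl.1 hw hv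
    · intro ω hω ω' hω' h
      have hsub {ω : Ω} (hω : ω ∈ Finset.univ.filter
          fun ω => ∀ v, v ∉ S → K.point v ∈ K.comp ω) : Sᶜ.image K.point ⊆ K.comp ω :=
        Finset.image_subset_iff.2 fun v hv =>
          (Finset.mem_filter.1 hω).2 v (by simpa using hv)
      have he : K.comp ω = K.comp ω' := by
        rw [← Finset.sdiff_union_of_subset (hsub hω), ← Finset.sdiff_union_of_subset (hsub hω')]
        exact congrArg (· ∪ Sᶜ.image K.point) h
      exact (K.existsUnique_comp_eq _ (K.existsUnique_mem_comp ω')).unique he rfl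
    · intro F hF
      replace hF := (Finset.mem_filter.1 hF).2
      obtain ⟨ω, hω, -⟩ := K.existsUnique_comp_eq _ hF.union_points
      refine ⟨ω, Finset.mem_filter.2 ⟨Finset.mem_univ _, fun v hv => ?_⟩, ?_⟩
      · rw [hω]
        exact Finset.mem_union_right _ (Finset.mem_image_of_mem _ (by simpa))
      · rw [hω]
        exact Finset.union_sdiff_cancel_right (hdis hF)
    · intro ω hω
      rw [Finset.sdiff_union_of_subset]
      exact Finset.image_subset_iff.2 fun v hv =>
          (Finset.mem_filter.1 hω).2 v (by simpa using hv)
  have hmul : (∑ F with K.IsAssembly F S, (-1 : ℚ) ^ (F ∪ Sᶜ.image K.point).card) =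
      K.signedCount S * (-1) ^ (Sᶜ.image K.point).card := by
    rw [signedCount, Finset.sum_mul]
    refine Finset.sum_congr rfl fun F hF => ?_
    rw [Finset.card_union_of_disjoint (hdis (Finset.mem_filter.1 hF).2), pow_add]
  rw [hmul] at key
  exact (mul_eq_zero.1 key).resolve_right (pow_ne_zero _ (by norm_num))

/-- A relation `m γ i j`, read as a set of components `γ` in each cell `(i, j)` of an array, such
that the supports of the components in each row partition `Fin n`. -/
def RowsPartition (m : Γ → Fin n → Fin n → Prop) : Prop :=
  ∀ i v, ∃! p : Γ × Fin n, m p.1 i p.2 ∧ v ∈ K.supp p.1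

open Classical in
/-- If each `m γ` is a function whose domain consists of the rows `i` for which `γ` is a component
of `σ i`, then row `i` of the array `m` is a decomposition of `Fin n`, namely that of `σ i`. -/
theorem forall_hasDomain_iff (m : Γ → Fin n → Fin n → Prop) (σ : Fin n → Ω) :
    (∀ γ, HasDomain (fun i => γ ∈ K.comp (σ i)) (m γ)) ↔
      K.RowsPartition m ∧ ∀ i, K.comp (σ i) = Finset.univ.filter fun γ => ∃ j, m γ i j := by
  constructor
  · intro h
    refine ⟨fun i v => ?_, fun i => ?_⟩
    · obtain ⟨γ, hγ, hu⟩ := K.existsUnique_mem_comp (σ i) v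
      obtain ⟨j, hj, hj'⟩ := (h γ).2 i hγ.1
      refine ⟨(γ, j), ⟨hj, hγ.2⟩, ?_⟩
      rintro ⟨γ', j'⟩ ⟨h1, h2⟩
      obtain rfl := hu γ' ⟨(h γ').1 i j' h1, h2⟩
      rw [hj' j' h1]
    · ext γ
      simp only [Finset.mem_filter, Finset.mem_univ, true_and]
      exact ⟨fun hγ => ((h γ).2 i hγ).exists, fun ⟨j, hj⟩ => (h γ).1 i j hj⟩
  · rintro ⟨h1, h2⟩ γ
    have h2' (i) : γ ∈ K.comp (σ i) ↔ ∃ j, m γ i j := by simp [h2]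
    refine ⟨fun i j hm => (h2' i).2 ⟨j, hm⟩, fun i hi => ?_⟩
    obtain ⟨j, hj⟩ := (h2' i).1 hi
    refine ⟨j, hj, fun j' hj' => ?_⟩
    obtain ⟨v, hv⟩ := K.supp_nonempty γ
    exact congrArg Prod.snd ((h1 i v).unique (y₁ := (γ, j')) (y₂ := (γ, j)) ⟨hj', hv⟩ ⟨hj, hv⟩)

open Classical in
theorem card_filter_hasDomain (m : Γ → Fin n → Fin n → Prop) :
    (Finset.univ.filter fun σ : Fin n → Ω =>
      ∀ γ, HasDomain (fun i => γ ∈ K.comp (σ i)) (m γ)).card =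
      if K.RowsPartition m then 1 else 0 := by
  simp only [forall_hasDomain_iff]
  split_ifs with h
  · have hex (i : Fin n) : ∃! ω, K.comp ω = Finset.univ.filter fun γ => ∃ j, m γ i j := by
      refine K.existsUnique_comp_eq _ fun v => ?_
      obtain ⟨p, hp, hu⟩ := h i v
      refine ⟨p.1, ⟨by simpa using ⟨p.2, hp.1⟩, hp.2⟩, ?_⟩
      rintro γ ⟨h1, h2⟩
      obtain ⟨j, hj⟩ := (Finset.mem_filter.1 h1).2
      exact congrArg Prod.fst (hu (γ, j) ⟨hj, h2⟩)
    choose f hf hu using hex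
    rw [Finset.card_eq_one]
    refine ⟨f, Finset.eq_singleton_iff_unique_mem.2 ⟨by simp [h, hf], fun σ hσ => ?_⟩⟩
    exact funext fun i => hu i _ ((Finset.mem_filter.1 hσ).2.2 i)
  · simp [h]

end ComponentSystem

/-! ### Cancellation in arrays of components -/

namespace ComponentSystem

variable {n : ℕ} {Ω Γ : Type*} [Fintype Ω] (K : ComponentSystem n Ω Γ)

variable {K} in
open Classical in
theorem RowsPartition.isAssembly {F : Fin n → Fin n → Finset Γ}
    (h : K.RowsPartition fun γ i j => γ ∈ F i j) (i j : Fin n) :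
    K.IsAssembly (F i j) ((F i j).biUnion K.supp) := by
  refine ⟨fun γ hγ => Finset.subset_biUnion_of_mem _ hγ, fun v hv => ?_⟩
  obtain ⟨γ, hγ, hv⟩ := Finset.mem_biUnion.1 hv
  refine ⟨γ, ⟨hγ, hv⟩, fun γ' hγ' => ?_⟩
  exact congrArg Prod.fst ((h i v).unique (y₁ := (γ', j)) (y₂ := (γ, j)) hγ' ⟨hγ, hv⟩)

theorem rowsPartition_iff {F : Fin n → Fin n → Finset Γ} {S : Fin n → Fin n → Finset (Fin n)}
    (h : ∀ i j, K.IsAssembly (F i j) (S i j)) :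
    (K.RowsPartition fun γ i j => γ ∈ F i j) ↔ ∀ i v, ∃! j, v ∈ S i j := by
  refine forall_congr' fun i => forall_congr' fun v => ⟨?_, ?_⟩
  · rintro ⟨⟨γ, j⟩, ⟨h1, h2⟩, hu⟩
    refine ⟨j, (h i j).1 γ h1 h2, fun j' hj' => ?_⟩
    obtain ⟨γ', hγ', -⟩ := (h i j').2 v hj'
    exact congrArg Prod.snd (hu (γ', j') hγ')
  · rintro ⟨j, hj, hu⟩
    obtain ⟨γ, hγ, hγu⟩ := (h i j).2 v hj
    refine ⟨(γ, j), hγ, ?_⟩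
    rintro ⟨γ', j'⟩ ⟨h1, h2⟩
    obtain rfl := hu j' ((h i j').1 γ' h1 h2)
    rw [hγu γ' ⟨h1, h2⟩]

/-- An array of subsets of `Fin n` in which every row and every column is a partition of `Fin n`
(into parts that may be empty). -/
def IsLatinArray {n : ℕ} (S : Fin n → Fin n → Finset (Fin n)) : Prop :=
  (∀ i v, ∃! j, v ∈ S i j) ∧ ∀ j v, ∃! i, v ∈ S i j

variable [Fintype Γ]

open Classical in
/-- Arrays of sets of components are summed by first fixing the set `S p` of elements covered in
each cell `p`; the cells then contribute independently. -/
theorem sum_rowsPartition_eq_sum_isLatinArray :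
    (∑ F : Fin n × Fin n → Finset Γ with
        (K.RowsPartition fun γ i j => γ ∈ F (i, j)) ∧
          K.RowsPartition fun γ j i => γ ∈ F (i, j), ∏ p, (-1 : ℚ) ^ (F p).card) =
      ∑ S : Fin n × Fin n → Finset (Fin n) with IsLatinArray fun i j => S (i, j),
        ∏ p, K.signedCount (S p) := by
  rw [← Finset.sum_fiberwise_of_maps_to
    (g := fun F p => (F p).biUnion K.supp)
    (t := Finset.univ.filter fun S : Fin n × Fin n → Finset (Fin n) =>
      IsLatinArray fun i j => S (i, j))]
  · refine Finset.sum_congr rfl fun S hS => ?_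
    replace hS := (Finset.mem_filter.1 hS).2
    simp only [signedCount]
    rw [Finset.prod_univ_sum]
    refine Finset.sum_congr (Finset.ext fun F => ?_) fun _ _ => rfl
    simp only [Finset.mem_filter, Finset.mem_univ, true_and, Fintype.mem_piFinset]
    constructor
    · rintro ⟨⟨h1, h2⟩, rfl⟩ p
      exact h1.isAssembly p.1 p.2
    · intro h
      refine ⟨⟨(K.rowsPartition_iff (S := fun i j => S (i, j)) fun i j => h (i, j)).2 hS.1, ?_⟩, ?_⟩
      · exact (K.rowsPartition_iff (F := fun j i => F (i, j)) (S := fun j i => S (i, j))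
          fun j i => h (i, j)).2 hS.2
      · exact funext fun p => (h p).biUnion_supp
  · intro F hF
    obtain ⟨h1, h2⟩ := (Finset.mem_filter.1 hF).2
    refine Finset.mem_filter.2 ⟨Finset.mem_univ _, ?_, ?_⟩
    · exact (K.rowsPartition_iff fun i j => h1.isAssembly i j).1 h1
    · exact (K.rowsPartition_iff (F := fun j i => F (i, j)) fun j i => h2.isAssembly j i).1 h2

theorem sum_card_of_isLatinArray {S : Fin n → Fin n → Finset (Fin n)} (hS : IsLatinArray S)
    (i : Fin n) : ∑ j, (S i j).card = n := by
  rw [← Finset.card_biUnion]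
  · rw [(Finset.eq_univ_iff_forall (s := Finset.univ.biUnion (S i))).2, Finset.card_univ,
      Fintype.card_fin]
    intro v
    obtain ⟨j, hj, -⟩ := hS.1 i v
    exact Finset.mem_biUnion.2 ⟨j, Finset.mem_univ _, hj⟩
  · intro j _ j' _ hne
    exact Finset.disjoint_left.2 fun v hv hv' => hne ((hS.1 i v).unique hv hv')

/-- The cells of a row have `n` elements in total, so unless all of them are singletons, some cell
of the array has at least two elements and kills the product. -/
theorem prod_signedCount_eq_zero {S : Fin n → Fin n → Finset (Fin n)} (hS : IsLatinArray S)
    (h : ¬ ∀ i j, (S i j).card = 1) :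
    ∏ p : Fin n × Fin n, K.signedCount (S p.1 p.2) = 0 := by
  obtain ⟨i, j, hij⟩ : ∃ i j, 1 < (S i j).card := by
    by_contra! hle
    push Not at h
    obtain ⟨i, j, hij⟩ := h
    have := Finset.sum_lt_sum (s := Finset.univ) (fun j _ => hle i j)
      ⟨j, Finset.mem_univ _, lt_of_le_of_ne (hle i j) hij⟩
    rw [sum_card_of_isLatinArray hS] at this
    simp at this
  exact Finset.prod_eq_zero (Finset.mem_univ (i, j)) (K.signedCount_eq_zero hij)

theorem isLatinArray_singleton_iff {n : ℕ} (M : Fin n → Fin n → Fin n) :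
    (IsLatinArray fun i j => {M i j}) ↔
      (∀ i, Function.Injective fun j => M i j) ∧ ∀ j, Function.Injective fun i => M i j := by
  unfold IsLatinArray
  simp only [Finset.mem_singleton, Finite.injective_iff_bijective,
    Function.bijective_iff_existsUnique, eq_comm]

open Classical in
theorem card_isLatinArray_eq_latinSquareCount (n : ℕ) :
    (Finset.univ.filter fun S : Fin n × Fin n → Finset (Fin n) =>
      (IsLatinArray fun i j => S (i, j)) ∧ ∀ p, (S p).card = 1).card = latinSquareCount n := by
  rw [← Fintype.card_subtype, ← Nat.card_eq_fintype_card]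
  refine (Nat.card_congr (Equiv.ofBijective (fun M => ⟨fun p => {M.1 p.1 p.2},
    (isLatinArray_singleton_iff M.1).2 M.2, fun p => by simp⟩) ⟨fun M M' h => ?_, ?_⟩)).symm
  · refine Subtype.ext (Matrix.ext fun i j => ?_)
    simpa using congrFun (congrArg Subtype.val h) (i, j)
  · rintro ⟨S, hS, hc⟩
    choose M hM using fun p => Finset.card_eq_one.1 (hc p)
    refine ⟨⟨fun i j => M (i, j), (isLatinArray_singleton_iff fun i j => M (i, j)).1 ?_⟩, ?_⟩
    · simpa [← hM] using hS
    · exact Subtype.ext (funext fun p => (hM p).symm)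

open Classical in
theorem sum_isLatinArray_eq_latinSquareCount :
    (∑ S : Fin n × Fin n → Finset (Fin n) with IsLatinArray fun i j => S (i, j),
        ∏ p, K.signedCount (S p)) = (-1) ^ n * latinSquareCount n := by
  have h1 : (∑ S : Fin n × Fin n → Finset (Fin n) with IsLatinArray fun i j => S (i, j),
        ∏ p, K.signedCount (S p)) =
      ∑ S : Fin n × Fin n → Finset (Fin n) with
        (IsLatinArray fun i j => S (i, j)) ∧ ∀ p, (S p).card = 1, (-1 : ℚ) ^ n := by
    rw [← Finset.filter_filter]
    conv_rhs => rw [Finset.sum_filter]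
    refine Finset.sum_congr rfl fun S hS => ?_
    replace hS := (Finset.mem_filter.1 hS).2
    split_ifs with h
    · rw [Finset.prod_congr rfl (g := fun _ => -1)]
      -- The sign is `(-1) ^ (n * n)`, and `n * n` has the parity of `n`.
      · simp only [Finset.prod_const, Finset.card_univ, Fintype.card_prod, Fintype.card_fin]
        rcases Nat.even_or_odd n with he | ho
        · rw [he.neg_one_pow, (he.mul_left n).neg_one_pow]
        · rw [ho.neg_one_pow, (ho.mul ho).neg_one_pow]
      · intro p _
        obtain ⟨v, hv⟩ := Finset.card_eq_one.1 (h p)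
        rw [hv, signedCount_singleton]
    · exact K.prod_signedCount_eq_zero (S := fun i j => S (i, j)) hS fun h' => h fun p => h' p.1 p.2
  rw [h1, Finset.sum_const, nsmul_eq_mul, mul_comm, card_isLatinArray_eq_latinSquareCount]

open Classical in
/-- Transposition: a family of sets of cells indexed by components is the same thing as a family of
sets of components indexed by cells. -/
theorem sum_matchings_eq_sum_rowsPartition :
    (∑ M : Γ → Finset (Fin n × Fin n) with
        (K.RowsPartition fun γ i j => (i, j) ∈ M γ) ∧
          K.RowsPartition fun γ j i => (i, j) ∈ M γ, ∏ γ, (-1 : ℚ) ^ (M γ).card) =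
    (∑ F : Fin n × Fin n → Finset Γ with
        (K.RowsPartition fun γ i j => γ ∈ F (i, j)) ∧
          K.RowsPartition fun γ j i => γ ∈ F (i, j), ∏ p, (-1 : ℚ) ^ (F p).card) := by
  refine Finset.sum_nbij' (fun M p => Finset.univ.filter fun γ => p ∈ M γ)
    (fun F γ => Finset.univ.filter fun p => γ ∈ F p) ?_ ?_ ?_ ?_ ?_
  · simp
  · simp
  · intro M _
    simp
  · intro F _
    simp
  · intro M _
    simp only [Finset.prod_pow_eq_pow_sum]
    congr 1
    have := Finset.sum_card_bipartiteAbove_eq_sum_card_bipartiteBelow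
      (s := (Finset.univ : Finset Γ)) (t := (Finset.univ : Finset (Fin n × Fin n)))
      (fun γ p => p ∈ M γ)
    simpa [Finset.bipartiteAbove, Finset.bipartiteBelow] using this

open Classical in
/-- The signed count of pairs of sequences `σ`, `τ` of structures, together with a matching of the
occurrences of each component `γ` in `σ` with those in `τ`. Such data amount to an array of sets of
components whose rows decompose into the `σ i` and whose columns decompose into the `τ j`. -/
theorem sum_sequences_eq_latinSquareCount :
    (∑ σ : Fin n → Ω, ∑ τ : Fin n → Ω, ∏ γ : Γ,
      if (Finset.univ.filter fun i => γ ∈ K.comp (σ i)).card =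
          (Finset.univ.filter fun i => γ ∈ K.comp (τ i)).card then
        (-1 : ℚ) ^ (Finset.univ.filter fun i => γ ∈ K.comp (σ i)).card *
          ((Finset.univ.filter fun i => γ ∈ K.comp (σ i)).card.factorial : ℚ)
      else 0) = (-1) ^ n * latinSquareCount n := by
  rw [← K.sum_isLatinArray_eq_latinSquareCount, ← sum_rowsPartition_eq_sum_isLatinArray,
    ← sum_matchings_eq_sum_rowsPartition]
  have hterm (σ τ : Fin n → Ω) : (∏ γ : Γ,
      if (Finset.univ.filter fun i => γ ∈ K.comp (σ i)).card =
          (Finset.univ.filter fun i => γ ∈ K.comp (τ i)).card then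
        (-1 : ℚ) ^ (Finset.univ.filter fun i => γ ∈ K.comp (σ i)).card *
          ((Finset.univ.filter fun i => γ ∈ K.comp (σ i)).card.factorial : ℚ)
      else 0) = ∑ M : Γ → Finset (Fin n × Fin n),
        if ∀ γ, IsMatchingBetween (fun i => γ ∈ K.comp (σ i)) (fun j => γ ∈ K.comp (τ j))
          (fun i j => (i, j) ∈ M γ) then ∏ γ, (-1 : ℚ) ^ (M γ).card else 0 := by
    have hγ (γ : Γ) : (if (Finset.univ.filter fun i => γ ∈ K.comp (σ i)).card =
          (Finset.univ.filter fun i => γ ∈ K.comp (τ i)).card then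
        (-1 : ℚ) ^ (Finset.univ.filter fun i => γ ∈ K.comp (σ i)).card *
          ((Finset.univ.filter fun i => γ ∈ K.comp (σ i)).card.factorial : ℚ)
      else 0) = ∑ m : Finset (Fin n × Fin n) with
        IsMatchingBetween (fun i => γ ∈ K.comp (σ i)) (fun j => γ ∈ K.comp (τ j))
          (fun i j => (i, j) ∈ m), (-1 : ℚ) ^ m.card := by
      rw [Finset.sum_congr rfl (g := fun _ =>
        (-1 : ℚ) ^ (Finset.univ.filter fun i => γ ∈ K.comp (σ i)).card)]
      · rw [Finset.sum_const, card_matchings, nsmul_eq_mul, mul_comm]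
        split_ifs <;> simp
      · intro m hm
        rw [(Finset.mem_filter.1 hm).2.card_eq]
    simp only [hγ]
    rw [Finset.prod_univ_sum, ← Finset.sum_filter]
    refine Finset.sum_congr (Finset.ext fun M => ?_) fun _ _ => rfl
    simp [Fintype.mem_piFinset]
  simp only [hterm]
  rw [Finset.sum_congr rfl fun σ _ => Finset.sum_comm, Finset.sum_comm, Finset.sum_filter]
  refine Finset.sum_congr rfl fun M _ => ?_
  simp only [IsMatchingBetween, forall_and, ite_and]
  simp only [Finset.sum_ite_irrel, Finset.sum_const_zero]
  simp only [← Finset.sum_filter, Finset.sum_const, card_filter_hasDomain]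
  split_ifs <;> simp_all

end ComponentSystem

/-! ### The formula for a system of components -/

namespace ComponentSystem

variable {n : ℕ} {Ω Γ : Type*} [Fintype Ω] (K : ComponentSystem n Ω Γ)

open Classical in
/-- The sum of the variables `x ω` over all the structures `ω` that have the component `γ`. -/
noncomputable def incidence (x : Ω → ℕ) (γ : Γ) : ℕ :=
  ∑ ω with γ ∈ K.comp ω, x ω

open Classical in
theorem incidence_count [DecidableEq Ω] (σ : Fin n → Ω) (γ : Γ) :
    K.incidence (fun ω => (Finset.univ.filter fun i => σ i = ω).card) γ =
      (Finset.univ.filter fun i => γ ∈ K.comp (σ i)).card := by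
  rw [incidence, Finset.card_eq_sum_card_fiberwise (f := σ)
    (t := Finset.univ.filter fun ω => γ ∈ K.comp ω) (by intro i hi; simpa using hi)]
  refine Finset.sum_congr rfl fun ω hω => ?_
  congr 1
  ext i
  simp only [Finset.mem_filter, Finset.mem_univ, true_and] at hω ⊢
  exact ⟨fun h => ⟨h ▸ hω, h⟩, fun h => h.2⟩

/-- The formula for `L(n)` attached to a component system. The pairs `(r, c)` are the types of the
pairs of sequences in `sum_sequences_eq_latinSquareCount`; the factor `(-1) ^ n * n!` of the weight
belongs to the empty component, which is not a member of `Γ`. -/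
theorem latinSquareCount_eq [Fintype Γ] [DecidableEq Ω]
    (matching : (Ω → ℕ) → Finset (Ω → ℕ)) (weight : (Ω → ℕ) → ℤ)
    (mem_matching : ∀ r c, c ∈ matching r ↔
      c ∈ Finset.piAntidiag Finset.univ n ∧ ∀ γ, K.incidence c γ = K.incidence r γ)
    (weight_eq : ∀ r, ∑ ω, r ω = n → weight r = ((-1) ^ n * (n.factorial : ℤ)) *
      ∏ γ, (-1) ^ K.incidence r γ * ((K.incidence r γ).factorial : ℤ)) :
    (latinSquareCount n : ℚ) = (n.factorial : ℚ) *
      ∑ r ∈ Finset.piAntidiag (Finset.univ : Finset Ω) n, ∑ c ∈ matching r,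
        (weight r : ℚ) / ((∏ ω, ((r ω).factorial : ℚ)) * ∏ ω, ((c ω).factorial : ℚ)) := by
  have h := K.sum_sequences_eq_latinSquareCount
  simp only [← incidence_count] at h
  rw [sum_sequences_eq_sum_piAntidiag (fun r => ∑ τ : Fin n → Ω, ∏ γ : Γ,
    if K.incidence r γ = K.incidence (fun ω => (Finset.univ.filter fun i => τ i = ω).card) γ then
      (-1 : ℚ) ^ K.incidence r γ * ((K.incidence r γ).factorial : ℚ) else 0)] at h
  have hL : (latinSquareCount n : ℚ) = (-1) ^ n * ((-1) ^ n * latinSquareCount n) := by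
    rw [← mul_assoc, ← mul_pow]
    simp
  rw [hL, ← h, Finset.mul_sum, Finset.mul_sum]
  refine Finset.sum_congr rfl fun r hr => ?_
  rw [sum_sequences_eq_sum_piAntidiag (fun c => ∏ γ : Γ, if K.incidence r γ = K.incidence c γ then
      (-1 : ℚ) ^ K.incidence r γ * ((K.incidence r γ).factorial : ℚ) else 0)]
  have hm : matching r = (Finset.piAntidiag Finset.univ n).filter fun c =>
      ∀ γ, K.incidence c γ = K.incidence r γ := by
    ext c
    rw [mem_matching, Finset.mem_filter]
  rw [hm, Finset.sum_filter, Finset.mul_sum, Finset.mul_sum, Finset.mul_sum]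
  refine Finset.sum_congr rfl fun c _ => ?_
  rw [weight_eq r (Finset.mem_piAntidiag.1 hr).1]
  split_ifs with hc
  · simp only [hc, if_true]
    push_cast
    field_simp
  · push Not at hc
    obtain ⟨γ, hγ⟩ := hc
    rw [Finset.prod_eq_zero (Finset.mem_univ γ) (if_neg (Ne.symm hγ))]
    simp

end ComponentSystem

/-! ### Permutations and their cycles -/

/-- `γ` is a cycle of `σ` if and only if `σ` acts as the successor map of `γ`. -/
theorem cycleOf_iff_next {n : ℕ} (γ : SimpleCycle n) (σ : Equiv.Perm (Fin n)) :
    CycleOf γ σ ↔ ∀ x (hx : x ∈ γ.1), σ x = γ.1.next γ.2 x hx := by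
  obtain ⟨γ, hγ⟩ := γ
  induction γ using Quotient.inductionOn' with | _ L
  change L.Nodup at hγ
  change Cycle.Chain (fun a b => σ a = b) (L : Cycle (Fin n)) ↔
    ∀ x (hx : x ∈ L), σ x = L.next x hx
  rcases L with _ | ⟨a, l⟩
  · simp
  have hlen : (a :: (l ++ [a])).length = (a :: l).length + 1 := by simp
  have hget (i : ℕ) (hi : i < (a :: l).length) :
      (a :: (l ++ [a]))[i + 1]'(by omega) =
        (a :: l)[(i + 1) % (a :: l).length]'(Nat.mod_lt _ (by simp)) := by
    rcases Nat.lt_or_ge (i + 1) (a :: l).length with h | h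
    · simp only [Nat.mod_eq_of_lt h, ← List.cons_append]
      rw [List.getElem_append_left]
    · have : i = l.length := by simp at hi h; omega
      subst this
      simp
  rw [Cycle.chain_coe_cons, List.isChain_iff_getElem]
  constructor
  · intro h x hx
    obtain ⟨i, hi, rfl⟩ := List.getElem_of_mem hx
    rw [List.next_getElem _ hγ i hi, ← hget i hi, ← h i (by omega)]
    simp only [← List.cons_append]
    rw [List.getElem_append_left]
  · intro h i hi
    have hi' : i < (a :: l).length := by omega
    rw [hget i hi', ← List.next_getElem _ hγ i hi', ← h]
    simp only [← List.cons_append]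
    rw [List.getElem_append_left]

theorem periodicOrbit_eq_iff_sameCycle {n : ℕ} (σ : Equiv.Perm (Fin n)) (v w : Fin n) :
    Function.periodicOrbit σ v = Function.periodicOrbit σ w ↔ σ.SameCycle v w := by
  have hper (y : Fin n) : y ∈ Function.periodicPts σ := σ.injective.mem_periodicPts y
  constructor
  · intro h
    have hw := Function.self_mem_periodicOrbit (hper w)
    rw [← h, Function.mem_periodicOrbit_iff (hper v)] at hw
    obtain ⟨k, rfl⟩ := hw
    exact ⟨k, by rw [zpow_natCast, Equiv.Perm.iterate_eq_pow]⟩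
  · intro h
    obtain ⟨k, -, rfl⟩ := h.exists_pow_eq'
    rw [← Equiv.Perm.iterate_eq_pow, Function.periodicOrbit_apply_iterate_eq (hper v)]

theorem card_image_eq_of_forall_eq_iff {α β γ : Type*} [DecidableEq β] [DecidableEq γ]
    {s : Finset α} {f : α → β} {g : α → γ} (h : ∀ x ∈ s, ∀ y ∈ s, f x = f y ↔ g x = g y) :
    (s.image f).card = (s.image g).card := by
  classical
  refine Finset.card_bij (fun b hb => g (Finset.mem_image.1 hb).choose) ?_ ?_ ?_
  · intro b hb
    exact Finset.mem_image_of_mem g (Finset.mem_image.1 hb).choose_spec.1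
  · intro b hb b' hb' he
    have h1 := (Finset.mem_image.1 hb).choose_spec
    have h2 := (Finset.mem_image.1 hb').choose_spec
    rw [← h1.2, ← h2.2]
    exact (h _ h1.1 _ h2.1).2 he
  · intro c hc
    obtain ⟨x, hx, rfl⟩ := Finset.mem_image.1 hc
    have hb := Finset.mem_image_of_mem f hx
    have h1 := (Finset.mem_image.1 hb).choose_spec
    exact ⟨f x, hb, (h _ h1.1 _ hx).1 h1.2⟩

open Classical in
/-- The number of cycles, with fixed points counted, determines the sign of a permutation. -/
theorem neg_one_pow_card_image_periodicOrbit {n : ℕ} (σ : Equiv.Perm (Fin n)) :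
    (-1 : ℤˣ) ^ (Finset.univ.image fun v => Function.periodicOrbit σ v).card =
      (-1) ^ n * Equiv.Perm.sign σ := by
  -- The orbits of the fixed points are counted one by one, those of the moved points by the cycle
  -- type.
  have hinj : Set.InjOn (fun v => Function.periodicOrbit σ v) (σ.supportᶜ : Finset (Fin n)) := by
    intro v hv w _ h
    obtain ⟨k, -, rfl⟩ := ((periodicOrbit_eq_iff_sameCycle σ v w).1 h).exists_pow_eq'
    rw [Equiv.Perm.pow_apply_eq_self_of_apply_eq_self (by simpa using hv)]
  have hcyc : (σ.support.image fun v => Function.periodicOrbit σ v).card = σ.cycleType.card := by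
    rw [card_image_eq_of_forall_eq_iff (g := fun v => σ.cycleOf v)]
    · rw [Equiv.Perm.cycleType_def, Multiset.card_map, Finset.card_val]
      congr 1
      ext τ
      rw [Finset.mem_image]
      constructor
      · rintro ⟨v, hv, rfl⟩
        exact Equiv.Perm.cycleOf_mem_cycleFactorsFinset_iff.2 hv
      · intro hτ
        obtain ⟨v, hv⟩ := (Equiv.Perm.mem_cycleFactorsFinset_iff.1 hτ).1.nonempty_support
        exact ⟨v, Equiv.Perm.mem_cycleFactorsFinset_support_le hτ hv,
          (Equiv.Perm.cycle_is_cycleOf hv hτ).symm⟩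
    · intro v hv w hw
      rw [periodicOrbit_eq_iff_sameCycle,
        Equiv.Perm.sameCycle_iff_cycleOf_eq_of_mem_support hv hw]
  have hdis : Disjoint (σ.support.image fun v => Function.periodicOrbit σ v)
      (σ.supportᶜ.image fun v => Function.periodicOrbit σ v) := by
    rw [Finset.disjoint_left]
    intro c hc hc'
    obtain ⟨v, hv, rfl⟩ := Finset.mem_image.1 hc
    obtain ⟨w, hw, h⟩ := Finset.mem_image.1 hc'
    have := ((periodicOrbit_eq_iff_sameCycle σ w v).1 h).mem_support_iff
    exact Finset.mem_compl.1 hw (this.2 hv)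
  have hn : σ.support.card ≤ n := by simpa using σ.support.card_le_univ
  rw [← Finset.union_compl σ.support, Finset.image_union, Finset.card_union_of_disjoint hdis,
    hcyc, Finset.card_image_of_injOn hinj, Finset.card_compl, Fintype.card_fin,
    Equiv.Perm.sign_of_cycleType, Equiv.Perm.sum_cycleType]
  have h3 : (-1 : ℤˣ) ^ n = (-1) ^ σ.support.card * (-1) ^ (n - σ.support.card) := by
    rw [← pow_add, Nat.add_sub_cancel' hn]
  have h2 : (-1 : ℤˣ) ^ σ.support.card * (-1) ^ σ.support.card = 1 := by
    rw [← mul_pow]; simp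
  rw [h3, pow_add, pow_add,
    show ∀ s t u : ℤˣ, s * t * (s * u) = s * s * (u * t) by intros; ac_rfl, h2, one_mul]

/-- The cycles on distinct elements of `Fin n`, without the empty cycle. -/
abbrev NonemptyCycle (n : ℕ) : Type := {γ : SimpleCycle n // γ.1 ≠ Cycle.nil}

theorem NonemptyCycle.exists_mem {n : ℕ} (γ : NonemptyCycle n) : ∃ v, v ∈ γ.1.1 := by
  obtain ⟨⟨γ, hγ⟩, h0⟩ := γ
  induction γ using Quotient.inductionOn' with | _ L
  rcases L with _ | ⟨a, l⟩
  · exact absurd rfl h0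
  · exact ⟨a, List.mem_cons_self⟩

theorem CycleOf.eq_of_mem {n : ℕ} {γ γ' : SimpleCycle n} {σ : Equiv.Perm (Fin n)} {v : Fin n}
    (h : CycleOf γ σ) (h' : CycleOf γ' σ) (hv : v ∈ γ.1) (hv' : v ∈ γ'.1) : γ = γ' :=
  Subtype.ext (((cycleOf_iff_periodicOrbit_eq γ v hv σ).1 h).symm.trans
    ((cycleOf_iff_periodicOrbit_eq γ' v hv' σ).1 h'))

/-- The cycle of length one at `v`. -/
def NonemptyCycle.point {n : ℕ} (v : Fin n) : NonemptyCycle n :=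
  ⟨⟨([v] : List (Fin n)), Cycle.nodup_coe_iff.2 (List.nodup_singleton v)⟩,
    fun h => Cycle.notMem_nil v (h ▸ Cycle.mem_coe_iff.2 (List.mem_singleton_self v))⟩

open Classical in
/-- The set of elements of a cycle. -/
noncomputable def NonemptyCycle.supp {n : ℕ} (γ : NonemptyCycle n) : Finset (Fin n) :=
  Finset.univ.filter fun v => v ∈ γ.1.1

open Classical in
/-- The nonempty cycles of a permutation. -/
noncomputable def cyclesOf {n : ℕ} (σ : Equiv.Perm (Fin n)) : Finset (NonemptyCycle n) :=
  Finset.univ.filter fun γ => CycleOf γ.1 σ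

theorem NonemptyCycle.mem_supp {n : ℕ} {γ : NonemptyCycle n} {v : Fin n} :
    v ∈ γ.supp ↔ v ∈ γ.1.1 := by
  simp [supp]

theorem mem_cyclesOf {n : ℕ} {σ : Equiv.Perm (Fin n)} {γ : NonemptyCycle n} :
    γ ∈ cyclesOf σ ↔ CycleOf γ.1 σ := by
  simp [cyclesOf]

theorem point_mem_cyclesOf_iff {n : ℕ} {σ : Equiv.Perm (Fin n)} {v : Fin n} :
    NonemptyCycle.point v ∈ cyclesOf σ ↔ σ v = v :=
  mem_cyclesOf.trans (Cycle.chain_singleton _ _)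

theorem NonemptyCycle.supp_eq_singleton_iff {n : ℕ} (γ : NonemptyCycle n) (v : Fin n) :
    γ.supp = {v} ↔ γ = NonemptyCycle.point v := by
  constructor
  · intro h
    obtain ⟨⟨γ, hγ⟩, h0⟩ := γ
    refine Subtype.ext (Subtype.ext ?_)
    change γ = (([v] : List (Fin n)) : Cycle (Fin n))
    induction γ using Quotient.inductionOn' with | _ L
    change L.Nodup at hγ
    have hp : L.Perm [v] := (List.perm_ext_iff_of_nodup hγ (List.nodup_singleton v)).2 fun w => by
      have := Finset.ext_iff.1 h w
      simpa [mem_supp] using this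
    rw [List.perm_singleton.1 hp]
    rfl
  · rintro rfl
    ext w
    simp [mem_supp, point]

theorem existsUnique_mem_cyclesOf {n : ℕ} (σ : Equiv.Perm (Fin n)) (v : Fin n) :
    ∃! γ, γ ∈ cyclesOf σ ∧ v ∈ γ.supp := by
  have hv := Function.self_mem_periodicOrbit (σ.injective.mem_periodicPts v)
  refine ⟨⟨⟨Function.periodicOrbit σ v, Function.nodup_periodicOrbit⟩, fun h => ?_⟩,
    ⟨mem_cyclesOf.2 ((cycleOf_iff_periodicOrbit_eq _ v hv σ).2 rfl),
      NonemptyCycle.mem_supp.2 hv⟩, ?_⟩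
  · rw [show Function.periodicOrbit σ v = Cycle.nil from h] at hv
    exact Cycle.notMem_nil _ hv
  · rintro γ ⟨h1, h2⟩
    exact Subtype.ext (Subtype.ext ((cycleOf_iff_periodicOrbit_eq γ.1 v
      (NonemptyCycle.mem_supp.1 h2) σ).1 (mem_cyclesOf.1 h1)).symm)

/-- A set of cycles that partitions `Fin n` is the set of cycles of the permutation that sends each
element to its successor in its cycle. -/
theorem existsUnique_cyclesOf_eq {n : ℕ} (F : Finset (NonemptyCycle n))
    (hF : ∀ v, ∃! γ, γ ∈ F ∧ v ∈ γ.supp) : ∃! σ, cyclesOf σ = F := by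
  choose g hg hu using hF
  have hgv (v : Fin n) : v ∈ (g v).1.1 := NonemptyCycle.mem_supp.1 (hg v).2
  have hgu {γ : NonemptyCycle n} (hγ : γ ∈ F) {v : Fin n}
      (hv : v ∈ γ.1.1) : γ = g v := hu v γ ⟨hγ, NonemptyCycle.mem_supp.2 hv⟩
  let f (v : Fin n) : Fin n := (g v).1.1.next (g v).1.2 v (hgv v)
  have hgf (v : Fin n) : g v = g (f v) := hgu (hg v).1 (Cycle.next_mem _ _ _ _)
  have hinj : Function.Injective f := by
    intro v w h
    have key (γ γ' : SimpleCycle n) (hv : v ∈ γ.1) (hw : w ∈ γ'.1) (he : γ = γ')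
        (hn : γ.1.next γ.2 v hv = γ'.1.next γ'.2 w hw) : v = w := by
      subst he
      rw [← Cycle.prev_next γ.1 γ.2 v hv, ← Cycle.prev_next γ.1 γ.2 w hw]
      congr 1
    exact key (g v).1 (g w).1 (hgv v) (hgv w)
      (congrArg Subtype.val ((hgf v).trans ((congrArg g h).trans (hgf w).symm))) h
  let σ := Equiv.ofBijective f (Finite.injective_iff_bijective.1 hinj)
  have hsub : ∀ γ ∈ F, CycleOf γ.1 σ := by
    intro γ hγ
    rw [cycleOf_iff_next]
    intro x hx
    have := hgu hγ hx
    subst this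
    rfl
  refine ⟨σ, Finset.ext fun γ => ?_, fun τ hτ => Equiv.ext fun v => ?_⟩
  · rw [mem_cyclesOf]
    refine ⟨fun h => ?_, hsub γ⟩
    obtain ⟨v, hv⟩ := γ.exists_mem
    rw [Subtype.ext (CycleOf.eq_of_mem h (hsub _ (hg v).1) hv (hgv v))]
    exact (hg v).1
  · have h1 : CycleOf (g v).1 τ := by
      rw [← mem_cyclesOf, hτ]
      exact (hg v).1
    rw [(cycleOf_iff_next _ _).1 h1 v (hgv v)]
    rfl

theorem neg_one_pow_card_cyclesOf {n : ℕ} (σ : Equiv.Perm (Fin n)) :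
    (-1 : ℚ) ^ (cyclesOf σ).card = (-1) ^ n * ((Equiv.Perm.sign σ : ℤ) : ℚ) := by
  classical
  have hcard : (cyclesOf σ).card =
      (Finset.univ.image fun v => Function.periodicOrbit σ v).card := by
    refine Finset.card_bij (fun γ _ => γ.1.1) (fun γ hγ => ?_)
      (fun γ _ γ' _ h => Subtype.ext (Subtype.ext h)) fun c hc => ?_
    · obtain ⟨v, hv⟩ := γ.exists_mem
      exact Finset.mem_image.2 ⟨v, Finset.mem_univ _,
        (cycleOf_iff_periodicOrbit_eq γ.1 v hv σ).1 (mem_cyclesOf.1 hγ)⟩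
    · obtain ⟨v, -, rfl⟩ := Finset.mem_image.1 hc
      obtain ⟨γ, ⟨h1, h2⟩, -⟩ := existsUnique_mem_cyclesOf σ v
      exact ⟨γ, h1, ((cycleOf_iff_periodicOrbit_eq γ.1 v (NonemptyCycle.mem_supp.1 h2) σ).1
        (mem_cyclesOf.1 h1)).symm⟩
  have := congrArg (fun u : ℤˣ => ((u : ℤ) : ℚ)) (neg_one_pow_card_image_periodicOrbit σ)
  rw [hcard]
  simpa using this

/-- There are as many even as odd permutations of a set with at least two elements. -/
theorem signed_sum_perm_eq_zero {n : ℕ} {S : Finset (Fin n)} (hS : 2 ≤ S.card) :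
    ∑ σ : Equiv.Perm (Fin n) with (∀ v, v ∉ S → σ v = v), (-1 : ℚ) ^ (cyclesOf σ).card = 0 := by
  obtain ⟨a, ha, b, hb, hab⟩ := Finset.one_lt_card.1 hS
  refine Finset.sum_involution (fun σ _ => Equiv.swap a b * σ) ?_ ?_ ?_ ?_
  · intro σ _
    simp [neg_one_pow_card_cyclesOf, Equiv.Perm.sign_swap hab]
  · intro σ _ _ h
    rw [mul_eq_right, Equiv.swap_eq_one_iff] at h
    exact hab h
  · intro σ hσ
    simp only [Finset.mem_filter, Finset.mem_univ, true_and] at hσ ⊢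
    intro v hv
    rw [Equiv.Perm.mul_apply, hσ v hv]
    exact Equiv.swap_apply_of_ne_of_ne (fun h => hv (h ▸ ha)) (fun h => hv (h ▸ hb))
  · intro σ _
    simp

/-- Permutations and their cycles. -/
noncomputable def cycleSystem (n : ℕ) :
    ComponentSystem n (Equiv.Perm (Fin n)) (NonemptyCycle n) where
  comp := cyclesOf
  supp := NonemptyCycle.supp
  point := NonemptyCycle.point
  supp_nonempty γ := by
    obtain ⟨v, hv⟩ := γ.exists_mem
    exact ⟨v, NonemptyCycle.mem_supp.2 hv⟩
  supp_eq_singleton_iff := NonemptyCycle.supp_eq_singleton_iff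
  existsUnique_mem_comp := existsUnique_mem_cyclesOf
  existsUnique_comp_eq := existsUnique_cyclesOf_eq
  signed_sum S hS := by
    rw [← signed_sum_perm_eq_zero hS]
    refine Finset.sum_congr (Finset.ext fun σ => ?_) fun _ _ => rfl
    simp only [Finset.mem_filter, Finset.mem_univ, true_and]
    exact forall_congr' fun v => imp_congr_right fun _ => point_mem_cyclesOf_iff

theorem incidence_cycleSystem {n : ℕ} (x : Equiv.Perm (Fin n) → ℕ) (γ : NonemptyCycle n) :
    (cycleSystem n).incidence x γ = cycleSum x γ.1 := by
  unfold ComponentSystem.incidence cycleSum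
  refine Finset.sum_congr (Finset.ext fun σ => ?_) fun _ _ => rfl
  simp only [Finset.mem_filter, Finset.mem_univ, true_and]
  exact mem_cyclesOf

theorem latinSquareCount_eq_sum_perm (n : ℕ) :
    (latinSquareCount n : ℚ) = (n.factorial : ℚ) *
      ∑ r ∈ Finset.piAntidiag (Finset.univ : Finset (Equiv.Perm (Fin n))) n,
        ∑ c ∈ cycleMatching r,
          ((∏ γ : SimpleCycle n, invFactorial (-(cycleSum r γ : ℤ)) : ℤ) : ℚ) /
            ((∏ σ, ((r σ).factorial : ℚ)) * ∏ σ, ((c σ).factorial : ℚ)) := by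
  classical
  refine (cycleSystem n).latinSquareCount_eq cycleMatching
    (fun r => ∏ γ : SimpleCycle n, invFactorial (-(cycleSum r γ : ℤ)))
    (fun r c => ?_) fun r hr => ?_
  · rw [cycleMatching, Finset.mem_filter]
    refine and_congr_right fun _ => ?_
    simp only [incidence_cycleSystem]
    exact ⟨fun h γ => h γ.1 γ.2, fun h γ hγ => h ⟨γ, hγ⟩⟩
  · simp only [incidence_cycleSystem, ← invFactorial_neg]
    rw [← Finset.mul_prod_erase _ _ (Finset.mem_univ ⟨Cycle.nil, Cycle.nodup_nil⟩), cycleSum_nil,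
      hr]
    congr 1
    refine Finset.prod_subtype _ (fun γ => ?_) _
    simp [Subtype.ext_iff]

/-! ### Index sequences and their components -/

namespace IndexSeq
variable {n : ℕ}

theorem idx_succ (α : IndexSeq n) (v : Fin n) : α.idx (v + 1) = α v := by
  have h : 1 ≤ v.1 + 1 ∧ v.1 + 1 ≤ n := ⟨by omega, v.2⟩
  simp [idx, h.2]

theorem idx_lt (α : IndexSeq n) {j : ℕ} (hj : 1 ≤ j) : α.idx j < j := by
  unfold idx
  split_ifs with h
  · have := (α ⟨j - 1, by omega⟩).isLt
    simp only at this
    omega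
  · omega

theorem iterate_idx_zero (α : IndexSeq n) (k : ℕ) : α.idx^[k] 0 = 0 :=
  Function.iterate_fixed α.idx_zero k

theorem iterate_idx_eq_zero (α : IndexSeq n) {h k : ℕ} (h0 : α.idx h = 0) (hk : 0 < k) :
    α.idx^[k] h = 0 := by
  obtain ⟨k, rfl⟩ := Nat.exists_eq_add_of_lt hk
  rw [Nat.zero_add, Function.iterate_succ_apply, h0, iterate_idx_zero]

theorem mem_component {α : IndexSeq n} {h : ℕ} {p : ℕ × ℕ} :
    p ∈ α.component h ↔ (1 ≤ p.1 ∧ p.1 ≤ n) ∧ (1 ≤ h ∧ α.idx h = 0 ∧ ∃ k, α.idx^[k] p.1 = h) ∧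
      p.2 = α.idx p.1 := by
  obtain ⟨j, a⟩ := p
  simp only [component, Finset.mem_image, Finset.mem_filter, Finset.mem_Icc, Prod.mk.injEq]
  constructor
  · rintro ⟨j, h, rfl, rfl⟩
    exact ⟨h.1, h.2, rfl⟩
  · rintro ⟨h1, h2, rfl⟩
    exact ⟨j, ⟨h1, h2⟩, rfl, rfl⟩

/-- Two indices `0` that are reached from the same position are equal: beyond an index `0` the
iteration stays at the position `0`, which does not exist. -/
theorem root_unique (α : IndexSeq n) {j h h' k k' : ℕ} (hh : 1 ≤ h) (hh' : 1 ≤ h')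
    (h0 : α.idx h = 0) (h0' : α.idx h' = 0) (hk : α.idx^[k] j = h) (hk' : α.idx^[k'] j = h') :
    h = h' := by
  wlog hle : k ≤ k' generalizing h h' k k'
  · exact (this hh' hh h0' h0 hk' hk (by omega)).symm
  obtain ⟨d, rfl⟩ := Nat.exists_eq_add_of_le' hle
  rw [Function.iterate_add_apply, hk] at hk'
  rcases Nat.eq_zero_or_pos d with rfl | hd
  · exact hk'
  · rw [iterate_idx_eq_zero α h0 hd] at hk'
    omega

theorem exists_root (α : IndexSeq n) {j : ℕ} (hj : 1 ≤ j) :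
    ∃ h, 1 ≤ h ∧ h ≤ j ∧ α.idx h = 0 ∧ ∃ k, α.idx^[k] j = h := by
  induction j using Nat.strong_induction_on with
  | _ j ih =>
    rcases Nat.eq_zero_or_pos (α.idx j) with h | h
    · exact ⟨j, hj, le_rfl, h, 0, rfl⟩
    · obtain ⟨r, h1, h2, h3, k, hk⟩ := ih (α.idx j) (α.idx_lt hj) h
      exact ⟨r, h1, h2.trans (α.idx_lt hj).le, h3, k + 1, hk⟩

/-- The index at `v` is a component by itself if it is `0` and no index covers it. -/
theorem component_eq_singleton_iff (α : IndexSeq n) (v : Fin n) :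
    α.component (v + 1) = {(v.1 + 1, 0)} ↔ α v = 0 ∧ ∀ w, (α w).1 ≠ v + 1 := by
  have hv : (α v = 0) ↔ α.idx (v + 1) = 0 := by rw [idx_succ, Fin.ext_iff, Fin.val_zero]
  rw [hv]
  constructor
  · intro h
    have h1 : (v.1 + 1, 0) ∈ α.component (v + 1) := by simp [h]
    have h0 := (mem_component.1 h1).2.1.2.1
    refine ⟨h0, fun w hw => ?_⟩
    have h2 : (w.1 + 1, α.idx (w + 1)) ∈ α.component (v + 1) :=
      mem_component.2 ⟨⟨by simp, w.2⟩, ⟨by simp, h0, 1, by simp [idx_succ, hw]⟩, rfl⟩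
    rw [h, Finset.mem_singleton, idx_succ, hw] at h2
    simpa using congrArg Prod.snd h2
  · rintro ⟨h0, h1⟩
    ext ⟨j, a⟩
    rw [mem_component, Finset.mem_singleton, Prod.mk.injEq]
    constructor
    · rintro ⟨hj, ⟨-, -, k, hk⟩, ha⟩
      simp only at hj hk ha
      have hjv : j = v + 1 := by
        rcases Nat.eq_zero_or_pos k with rfl | hk0
        · exact hk
        · obtain ⟨k, rfl⟩ := Nat.exists_eq_add_of_lt hk0
          rw [Nat.zero_add, Function.iterate_succ_apply'] at hk
          exfalso
          generalize α.idx^[k] j = i at hk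
          unfold idx at hk
          split_ifs at hk with hi
          · exact h1 _ hk
      exact ⟨hjv, by rw [ha, hjv, h0]⟩
    · rintro ⟨rfl, rfl⟩
      exact ⟨⟨by simp, v.2⟩, ⟨by simp, h0, 0, rfl⟩, h0.symm⟩

theorem self_mem_component {α : IndexSeq n} {h : ℕ} (h1 : 1 ≤ h) (hn : h ≤ n)
    (h0 : α.idx h = 0) : (h, 0) ∈ α.component h :=
  mem_component.2 ⟨⟨h1, hn⟩, ⟨h1, h0, 0, rfl⟩, h0.symm⟩

end IndexSeq

/-- The components `Z_l`, `1 ≤ l ≤ n`, of index sequences, tagged with the position `l` of their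
root. -/
abbrev RootedComponent (n : ℕ) : Type :=
  {γ : (_ : ℕ) × Finset (ℕ × ℕ) // γ ∈ (Finset.Icc 1 n).sigma (components n)}

theorem RootedComponent.exists_indexSeq {n : ℕ} (γ : RootedComponent n) :
    ∃ β : IndexSeq n, (1 ≤ γ.1.1 ∧ γ.1.1 ≤ n) ∧ β.idx γ.1.1 = 0 ∧
      β.component γ.1.1 = γ.1.2 := by
  obtain ⟨h1, h2⟩ := Finset.mem_sigma.1 γ.2
  obtain ⟨β, hβ, h⟩ := Finset.mem_image.1 h2
  exact ⟨β, Finset.mem_Icc.1 h1, (Finset.mem_filter.1 hβ).2, h⟩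

theorem RootedComponent.root_mem {n : ℕ} (γ : RootedComponent n) : (γ.1.1, 0) ∈ γ.1.2 := by
  obtain ⟨β, ⟨h1, hn⟩, h0, h⟩ := γ.exists_indexSeq
  rw [← h]
  exact IndexSeq.self_mem_component h1 hn h0

/-- The component of `α` with root `h`. -/
noncomputable def IndexSeq.rootedComponent {n : ℕ} (α : IndexSeq n) (h : ℕ) (h1 : 1 ≤ h)
    (hn : h ≤ n) (h0 : α.idx h = 0) : RootedComponent n :=
  ⟨⟨h, α.component h⟩, Finset.mem_sigma.2 ⟨Finset.mem_Icc.2 ⟨h1, hn⟩,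
    Finset.mem_image_of_mem _ (Finset.mem_filter.2 ⟨Finset.mem_univ _, h0⟩)⟩⟩

open Classical in
/-- The nonempty components of an index sequence. -/
noncomputable def IndexSeq.rootedComponents {n : ℕ} (α : IndexSeq n) : Finset (RootedComponent n) :=
  Finset.univ.filter fun γ => α.component γ.1.1 = γ.1.2

open Classical in
/-- The positions of the indices in a component, shifted to `Fin n`. -/
noncomputable def RootedComponent.supp {n : ℕ} (γ : RootedComponent n) : Finset (Fin n) :=
  Finset.univ.filter fun v => ∃ a, (v.1 + 1, a) ∈ γ.1.2

theorem IndexSeq.mem_rootedComponents {n : ℕ} {α : IndexSeq n} {γ : RootedComponent n} :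
    γ ∈ α.rootedComponents ↔ α.component γ.1.1 = γ.1.2 := by
  simp [rootedComponents]

theorem RootedComponent.mem_supp {n : ℕ} {γ : RootedComponent n} {v : Fin n} :
    v ∈ γ.supp ↔ ∃ a, (v.1 + 1, a) ∈ γ.1.2 := by
  simp [supp]

theorem IndexSeq.idx_eq_zero_of_mem_rootedComponents {n : ℕ} {α : IndexSeq n}
    {γ : RootedComponent n} (h : γ ∈ α.rootedComponents) : α.idx γ.1.1 = 0 := by
  have := γ.root_mem
  rw [← mem_rootedComponents.1 h] at this
  exact (mem_component.1 this).2.1.2.1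

theorem IndexSeq.existsUnique_mem_rootedComponents {n : ℕ} (α : IndexSeq n) (v : Fin n) :
    ∃! γ, γ ∈ α.rootedComponents ∧ v ∈ γ.supp := by
  obtain ⟨h, h1, h2, h0, k, hk⟩ := α.exists_root (j := v + 1) (by omega)
  refine ⟨α.rootedComponent h h1 (h2.trans v.2) h0, ⟨mem_rootedComponents.2 rfl,
    RootedComponent.mem_supp.2 ⟨α.idx (v + 1),
      mem_component.2 ⟨⟨by simp, v.2⟩, ⟨h1, h0, k, hk⟩, rfl⟩⟩⟩, ?_⟩
  rintro γ ⟨hγ, hv⟩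
  obtain ⟨a, ha⟩ := RootedComponent.mem_supp.1 hv
  rw [mem_rootedComponents] at hγ
  rw [← hγ, mem_component] at ha
  obtain ⟨-, ⟨h1', h0', k', hk'⟩, -⟩ := ha
  have hr := α.root_unique h1' h1 h0' h0 hk' hk
  obtain ⟨⟨l, Z⟩, hlZ⟩ := γ
  simp only at hr hγ
  subst hr hγ
  rfl

/-- If `α` takes the values of `β` on the component of `β` with root `l`, then the root `l` is also
reached under `α` from there, since covering does not leave the component. -/
theorem IndexSeq.iterate_idx_eq_of_eqOn_component {n : ℕ} {α β : IndexSeq n} {l : ℕ}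
    (h0 : β.idx l = 0) (h : ∀ p ∈ β.component l, α.idx p.1 = p.2) (hl : 1 ≤ l) :
    ∀ k j, 1 ≤ j → j ≤ n → β.idx^[k] j = l → α.idx^[k] j = l := by
  intro k
  induction k with
  | zero => exact fun j _ _ hj => hj
  | succ k ih =>
    intro j hj hjn hk
    have hαβ : α.idx j = β.idx j :=
      h (j, β.idx j) (mem_component.2 ⟨⟨hj, hjn⟩, ⟨hl, h0, k + 1, hk⟩, rfl⟩)
    rw [Function.iterate_succ_apply] at hk ⊢
    rw [hαβ]
    refine ih _ (Nat.one_le_iff_ne_zero.2 fun hz => ?_) ((β.idx_lt hj).le.trans hjn) hk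
    rw [hz, iterate_idx_zero] at hk
    omega

/-- The sequence with given components is read off from the pairs of positions and values in them.
-/
theorem IndexSeq.existsUnique_rootedComponents_eq {n : ℕ} (F : Finset (RootedComponent n))
    (hF : ∀ v, ∃! γ, γ ∈ F ∧ v ∈ γ.supp) : ∃! α : IndexSeq n, α.rootedComponents = F := by
  choose g hg hu using hF
  choose a ha using fun v => RootedComponent.mem_supp.1 (hg v).2
  have hav (v : Fin n) : a v < v + 1 := by
    obtain ⟨β, -, -, hβ⟩ := (g v).exists_indexSeq
    have := ha v
    rw [← hβ, mem_component] at this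
    exact this.2.2.trans_lt (β.idx_lt (by omega))
  let α : IndexSeq n := fun v => ⟨a v, hav v⟩
  have hα {γ : RootedComponent n} (hγ : γ ∈ F) : ∀ p ∈ γ.1.2, α.idx p.1 = p.2 := by
    rintro ⟨j, b⟩ hp
    obtain ⟨β, -, -, hβ⟩ := γ.exists_indexSeq
    rw [← hβ] at hp
    have hp' := mem_component.1 hp
    obtain ⟨v, rfl⟩ : ∃ v : Fin n, j = v + 1 :=
      ⟨⟨j - 1, by have := hp'.1; simp only at this; omega⟩, by
        have := hp'.1; simp only at this ⊢; omega⟩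
    have hγv : γ = g v := hu v γ ⟨hγ, RootedComponent.mem_supp.2 ⟨b, hβ ▸ hp⟩⟩
    have hv := ha v
    rw [← hγv, ← hβ, mem_component] at hv
    rw [idx_succ]
    exact hv.2.2.trans hp'.2.2.symm
  have hsub {γ : RootedComponent n} (hγ : γ ∈ F) : γ ∈ α.rootedComponents := by
    have hreach {γ : RootedComponent n} (hγ : γ ∈ F) {j b : ℕ} (hj : (j, b) ∈ γ.1.2) :
        ∃ k, α.idx^[k] j = γ.1.1 := by
      obtain ⟨β, ⟨hl, -⟩, h0, hβ⟩ := γ.exists_indexSeq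
      rw [← hβ] at hj
      obtain ⟨⟨h1, h2⟩, ⟨-, -, k, hk⟩, -⟩ := mem_component.1 hj
      exact ⟨k, iterate_idx_eq_of_eqOn_component h0 (fun p hp => hα hγ p (hβ ▸ hp)) hl k j h1 h2 hk⟩
    have hroot {γ : RootedComponent n} (hγ : γ ∈ F) : α.idx γ.1.1 = 0 := hα hγ _ γ.root_mem
    obtain ⟨β, ⟨hl, hln⟩, h0, hβ⟩ := γ.exists_indexSeq
    rw [mem_rootedComponents]
    ext ⟨j, b⟩
    constructor
    · intro hj
      obtain ⟨⟨h1, h2⟩, ⟨-, -, k, hk⟩, hb⟩ := mem_component.1 hj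
      simp only at h1 h2 hk hb
      obtain ⟨v, rfl⟩ : ∃ v : Fin n, j = v + 1 :=
        ⟨⟨j - 1, by omega⟩, by simp only; omega⟩
      obtain ⟨β', ⟨hl', hln'⟩, -, -⟩ := (g v).exists_indexSeq
      obtain ⟨k', hk'⟩ := hreach (hg v).1 (ha v)
      have hll := α.root_unique hl hl' (hroot hγ) (hroot (hg v).1) hk hk'
      obtain ⟨w, hw⟩ : ∃ w : Fin n, γ.1.1 = w + 1 :=
        ⟨⟨γ.1.1 - 1, by omega⟩, by simp only; omega⟩
      have h1 : γ = g w := hu w γ ⟨hγ, RootedComponent.mem_supp.2 ⟨0, hw ▸ γ.root_mem⟩⟩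
      have h2 : g v = g w := hu w (g v) ⟨(hg v).1, RootedComponent.mem_supp.2 ⟨0, by
        rw [← hw, hll]
        exact (g v).root_mem⟩⟩
      rw [h1, ← h2, hb, idx_succ]
      exact ha v
    · intro hj
      obtain ⟨k, hk⟩ := hreach hγ hj
      have hj' := hj
      rw [← hβ] at hj'
      exact mem_component.2 ⟨(mem_component.1 hj').1, ⟨hl, hroot hγ, k, hk⟩, (hα hγ _ hj).symm⟩
  refine ⟨α, Finset.ext fun γ => ⟨fun hγ => ?_, hsub⟩, fun α' hα' => ?_⟩
  · obtain ⟨w, hw⟩ : ∃ w : Fin n, γ.1.1 = w + 1 := by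
      obtain ⟨β', ⟨hl', hln'⟩, -, -⟩ := γ.exists_indexSeq
      exact ⟨⟨γ.1.1 - 1, by omega⟩, by simp only; omega⟩
    rw [(α.existsUnique_mem_rootedComponents w).unique
      ⟨hγ, RootedComponent.mem_supp.2 ⟨0, hw ▸ γ.root_mem⟩⟩ ⟨hsub (hg w).1, (hg w).2⟩]
    exact (hg w).1
  · funext v
    refine Fin.ext ?_
    have h1 := (hg v).1
    rw [← hα', mem_rootedComponents] at h1
    have := ha v
    rw [← h1, mem_component, idx_succ] at this
    exact this.2.2.symm

/-- The components correspond to their roots, the positions of the indices `0`. -/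
theorem IndexSeq.neg_one_pow_card_rootedComponents {n : ℕ} (α : IndexSeq n) :
    (-1 : ℚ) ^ α.rootedComponents.card = ∏ v, if α v = 0 then -1 else 1 := by
  have hcard : α.rootedComponents.card = (Finset.univ.filter fun v => α v = 0).card := by
    symm
    have h0 {v : Fin n} (hv : v ∈ Finset.univ.filter fun v => α v = 0) : α.idx (v + 1) = 0 := by
      rw [idx_succ, (Finset.mem_filter.1 hv).2]
      rfl
    refine Finset.card_bij (fun v hv => α.rootedComponent (v + 1) (by omega) v.2 (h0 hv))
      (fun v hv => mem_rootedComponents.2 rfl) (fun v _ w _ h => ?_) fun γ hγ => ?_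
    · have := congrArg (fun γ : RootedComponent n => γ.1.1) h
      simpa [rootedComponent, Fin.ext_iff] using this
    · have hz := idx_eq_zero_of_mem_rootedComponents hγ
      obtain ⟨-, ⟨hl, hln⟩, -, -⟩ := γ.exists_indexSeq
      rw [mem_rootedComponents] at hγ
      obtain ⟨⟨l, Z⟩, hlZ⟩ := γ
      simp only at hz hl hln hγ
      obtain ⟨w, rfl⟩ : ∃ w : Fin n, l = w + 1 := ⟨⟨l - 1, by omega⟩, by simp only; omega⟩
      subst hγ
      exact ⟨w, Finset.mem_filter.2 ⟨Finset.mem_univ _, Fin.ext (by rwa [idx_succ] at hz)⟩, rfl⟩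
  rw [hcard, Finset.prod_ite]
  simp

/-- Let `a < b` be the two smallest elements of `S`. The index at `b` is `0` or covers the index at
`a`, and switching between these two possibilities is a sign-reversing involution on the index
sequences whose components outside `S` are single points. -/
theorem IndexSeq.signed_sum_eq_zero {n : ℕ} {S : Finset (Fin n)} (hS : 2 ≤ S.card) :
    ∑ α : IndexSeq n with (∀ v : Fin n, v ∉ S → α v = 0 ∧ ∀ w, (α w).1 ≠ v.1 + 1),
      (-1 : ℚ) ^ α.rootedComponents.card = 0 := by
  obtain ⟨a, b, ha, hb, hab, hmin⟩ : ∃ a b, a ∈ S ∧ b ∈ S ∧ a < b ∧ ∀ w ∈ S, w < b → w = a := by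
    have h1 : S.Nonempty := Finset.card_pos.1 (by omega)
    have h2 : (S.erase (S.min' h1)).Nonempty :=
      Finset.card_pos.1 (by rw [Finset.card_erase_of_mem (S.min'_mem h1)]; omega)
    have hb := Finset.mem_erase.1 ((S.erase (S.min' h1)).min'_mem h2)
    refine ⟨S.min' h1, _, S.min'_mem h1, hb.2, lt_of_le_of_ne (S.min'_le _ hb.2) hb.1.symm,
      fun w hw hlt => ?_⟩
    by_contra hne
    exact absurd (Finset.min'_le _ w (Finset.mem_erase.2 ⟨hne, hw⟩)) (not_le.2 hlt)
  -- `a'` is the index at `b` that covers the index at `a`; positions count from one.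
  let a' : Fin (b.1 + 1) := ⟨a + 1, Nat.succ_lt_succ hab⟩
  have ha' : a' ≠ 0 := fun h => by simpa [a'] using congrArg Fin.val h
  let toggle (α : IndexSeq n) : IndexSeq n := Function.update α b (if α b = 0 then a' else 0)
  have hb_self (α : IndexSeq n) : toggle α b = if α b = 0 then a' else 0 :=
    Function.update_self _ _ _
  have hb_ne (α : IndexSeq n) {w : Fin n} (hw : w ≠ b) : toggle α w = α w :=
    Function.update_of_ne hw _ _
  refine Finset.sum_involution (fun α _ => toggle α) ?_ ?_ ?_ ?_
  · intro α _
    simp only [neg_one_pow_card_rootedComponents]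
    rw [← Finset.mul_prod_erase _ _ (Finset.mem_univ b), ← Finset.mul_prod_erase _
      (fun v => if toggle α v = 0 then (-1 : ℚ) else 1) (Finset.mem_univ b)]
    rw [Finset.prod_congr rfl (s₁ := Finset.univ.erase b)
      (f := fun v => if toggle α v = 0 then (-1 : ℚ) else 1)
      (g := fun v => if α v = 0 then (-1 : ℚ) else 1)
      fun w hw => by rw [hb_ne α (Finset.ne_of_mem_erase hw)], hb_self]
    by_cases h : α b = 0 <;> simp [h, ha']
  · intro α _ _ h
    have := congrFun h b
    rw [hb_self] at this
    split_ifs at this with h0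
    · exact ha' (this.trans h0)
    · exact h0 this.symm
  · intro α hα
    simp only [Finset.mem_filter, Finset.mem_univ, true_and] at hα ⊢
    intro v hv
    have hvb : v ≠ b := fun h => hv (h ▸ hb)
    refine ⟨(hb_ne α hvb).trans (hα v hv).1, fun w hw => ?_⟩
    by_cases hwb : w = b
    · subst hwb
      rw [hb_self] at hw
      split_ifs at hw with h0
      · have : a = v := Fin.ext (by simpa [a'] using hw)
        exact hv (this ▸ ha)
      · simp at hw
    · rw [hb_ne α hwb] at hw
      exact (hα v hv).2 w hw
  · intro α hα
    simp only [Finset.mem_filter, Finset.mem_univ, true_and] at hα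
    funext w
    by_cases hwb : w = b
    · subst hwb
      rw [hb_self, hb_self]
      by_cases h0 : α w = 0
      · simp [h0, ha']
      · simp only [h0, if_false, if_true]
        obtain ⟨p, hp⟩ : ∃ p, (α w).1 = p + 1 :=
          Nat.exists_eq_succ_of_ne_zero fun h => h0 (Fin.ext h)
        have hpw : p < w.1 := by have := (α w).2; omega
        let u : Fin n := ⟨p, hpw.trans w.2⟩
        have hu : u ∈ S := by
          by_contra hu
          exact (hα u hu).2 w hp
        have : u = a := hmin u hu hpw
        refine Fin.ext ?_
        rw [hp]
        exact congrArg (fun x : Fin n => x.1 + 1) this.symm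
    · rw [hb_ne _ hwb, hb_ne _ hwb]

/-- The component of the single index `0` at the position of `v`. -/
noncomputable def RootedComponent.point {n : ℕ} (v : Fin n) : RootedComponent n :=
  ⟨⟨v + 1, {(v.1 + 1, 0)}⟩, Finset.mem_sigma.2 ⟨Finset.mem_Icc.2 ⟨by simp, v.2⟩,
    Finset.mem_image.2 ⟨fun _ => 0, Finset.mem_filter.2 ⟨Finset.mem_univ _, by
      rw [IndexSeq.idx_succ]; rfl⟩,
      (IndexSeq.component_eq_singleton_iff _ v).2 ⟨rfl, fun w h => by simp at h⟩⟩⟩⟩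

theorem RootedComponent.supp_eq_singleton_iff {n : ℕ} (γ : RootedComponent n) (v : Fin n) :
    γ.supp = {v} ↔ γ = RootedComponent.point v := by
  constructor
  · intro h
    have hmem (w : Fin n) (b : ℕ) (hw : (w.1 + 1, b) ∈ γ.1.2) : w = v := by
      have : w ∈ γ.supp := mem_supp.2 ⟨b, hw⟩
      rwa [h, Finset.mem_singleton] at this
    have hroot := γ.root_mem
    obtain ⟨β, ⟨hl, hln⟩, h0, hβ⟩ := γ.exists_indexSeq
    obtain ⟨⟨l, Z⟩, hlZ⟩ := γ
    simp only at hl hln h0 hβ hmem hroot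
    obtain ⟨w, rfl⟩ : ∃ w : Fin n, l = w + 1 := ⟨⟨l - 1, by omega⟩, by simp only; omega⟩
    obtain rfl := hmem w 0 hroot
    have hZ : Z = {(w.1 + 1, 0)} := by
      refine Finset.eq_singleton_iff_unique_mem.2 ⟨hroot, ?_⟩
      rintro ⟨j, b⟩ hj
      have hj' := hj
      rw [← hβ, IndexSeq.mem_component] at hj'
      obtain ⟨⟨h1, h2⟩, -, hb⟩ := hj'
      simp only at h1 h2 hb
      obtain ⟨u, rfl⟩ : ∃ u : Fin n, j = u + 1 := ⟨⟨j - 1, by omega⟩, by simp only; omega⟩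
      obtain rfl := hmem u b hj
      rw [hb, h0]
    subst hZ
    rfl
  · rintro rfl
    ext w
    simp [mem_supp, point, Fin.ext_iff]

/-- Index sequences and their components. -/
noncomputable def indexSystem (n : ℕ) : ComponentSystem n (IndexSeq n) (RootedComponent n) where
  comp := IndexSeq.rootedComponents
  supp := RootedComponent.supp
  point := RootedComponent.point
  supp_nonempty γ := by
    obtain ⟨-, ⟨hl, hln⟩, -, -⟩ := γ.exists_indexSeq
    refine ⟨⟨γ.1.1 - 1, by omega⟩, RootedComponent.mem_supp.2 ⟨0, ?_⟩⟩
    simp only [Nat.sub_add_cancel hl]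
    exact γ.root_mem
  supp_eq_singleton_iff := RootedComponent.supp_eq_singleton_iff
  existsUnique_mem_comp := IndexSeq.existsUnique_mem_rootedComponents
  existsUnique_comp_eq := IndexSeq.existsUnique_rootedComponents_eq
  signed_sum S hS := by
    rw [← IndexSeq.signed_sum_eq_zero hS]
    refine Finset.sum_congr (Finset.ext fun α => ?_) fun _ _ => rfl
    simp only [Finset.mem_filter, Finset.mem_univ, true_and]
    refine forall_congr' fun v => imp_congr_right fun _ => ?_
    rw [IndexSeq.mem_rootedComponents, ← IndexSeq.component_eq_singleton_iff]
    rfl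

theorem incidence_indexSystem {n : ℕ} (x : IndexSeq n → ℕ) (γ : RootedComponent n) :
    (indexSystem n).incidence x γ = compSum x γ.1.1 γ.1.2 := by
  unfold ComponentSystem.incidence compSum
  refine Finset.sum_congr (Finset.ext fun α => ?_) fun _ _ => rfl
  simp only [Finset.mem_filter, Finset.mem_univ, true_and]
  exact IndexSeq.mem_rootedComponents

theorem latinSquareCount_eq_sum_indexSeq (n : ℕ) :
    (latinSquareCount n : ℚ) = (n.factorial : ℚ) *
      ∑ r ∈ Finset.piAntidiag (Finset.univ : Finset (IndexSeq n)) n, ∑ c ∈ compMatching r,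
        ((∏ l ∈ Finset.range (n + 1), ∏ Z ∈ components n l,
            invFactorial (-(compSum r l Z : ℤ)) : ℤ) : ℚ) /
          ((∏ α, ((r α).factorial : ℚ)) * ∏ α, ((c α).factorial : ℚ)) := by
  refine (indexSystem n).latinSquareCount_eq compMatching (fun r => ∏ l ∈ Finset.range (n + 1),
    ∏ Z ∈ components n l, invFactorial (-(compSum r l Z : ℤ))) (fun r c => ?_) fun r hr => ?_
  · unfold compMatching
    simp only [Finset.mem_filter, incidence_indexSystem]
    refine and_congr_right fun _ => ?_
    constructor
    · intro h γ
      obtain ⟨h1, h2⟩ := Finset.mem_sigma.1 γ.2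
      exact h _ h1 _ h2
    · exact fun h l hl Z hZ => h ⟨⟨l, Z⟩, Finset.mem_sigma.2 ⟨hl, hZ⟩⟩
  · simp only [incidence_indexSystem, ← invFactorial_neg]
    have hrange : Finset.range (n + 1) = insert 0 (Finset.Icc 1 n) := by
      ext l
      simp only [Finset.mem_range, Finset.mem_insert, Finset.mem_Icc]
      omega
    rw [hrange, Finset.prod_insert (by simp), components_zero, Finset.prod_singleton, compSum_zero,
      hr, Finset.prod_sigma', ← Finset.prod_coe_sort]


end LatinFormula

theorem theorem9p1 (n : ℕ) (hn : 1 ≤ n) :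
    (Fintype.card (LatinFormula.IndexSeq n) = n.factorial ∧
      Fintype.card (Equiv.Perm (Fin n)) = n.factorial) ∧
    (LatinFormula.latinSquareCount n : ℚ) =
      (n.factorial : ℚ) *
        ∑ r ∈ Finset.piAntidiag (Finset.univ : Finset (LatinFormula.IndexSeq n)) n,
          ∑ c ∈ LatinFormula.compMatching r,
            ((∏ l ∈ Finset.range (n + 1), ∏ Z ∈ LatinFormula.components n l,
                LatinFormula.invFactorial (-(LatinFormula.compSum r l Z : ℤ)) : ℤ) : ℚ) /
              ((∏ α, ((r α).factorial : ℚ)) * ∏ α, ((c α).factorial : ℚ)) ∧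
    (LatinFormula.latinSquareCount n : ℚ) =
      (n.factorial : ℚ) *
        ∑ r ∈ Finset.piAntidiag (Finset.univ : Finset (Equiv.Perm (Fin n))) n,
          ∑ c ∈ LatinFormula.cycleMatching r,
            ((∏ γ : LatinFormula.SimpleCycle n,
                LatinFormula.invFactorial (-(LatinFormula.cycleSum r γ : ℤ)) : ℤ) : ℚ) /
              ((∏ σ, ((r σ).factorial : ℚ)) * ∏ σ, ((c σ).factorial : ℚ)) :=
  ⟨⟨LatinFormula.card_indexSeq n, by rw [Fintype.card_perm, Fintype.card_fin]⟩,
    LatinFormula.latinSquareCount_eq_sum_indexSeq n, LatinFormula.latinSquareCount_eq_sum_perm n⟩
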